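/- For $m\ge 1$ let $[m]=\{1<\dots<m\}$, and let $NC^{(A)}(m)$ be the set of non-crossing partitions of $[m]$, i.e. partitions $p$ such that $a<b<c<d$, $a\sim_p c$, $b\sim_p d$ imply $a\sim_p b$. Let $\overline{[m]}=\{\overline 1<\dots<\overline m\}$ be a copy of $[m]$, and order $[m]\cup\overline{[m]}$ by $1<\overline 1<2<\overline 2<\dots<m<\overline m$. The Kreweras complement $\mathrm{Kr}(p)$ of $p\in NC^{(A)}(m)$ is the biggest partition $q$ of $\overline{[m]}$ such that $p\cup q$ is a non-crossing partition of $[m]\cup\overline{[m]}$, where $q\preceq q'$ means that every block of $q$ is contained in a block of $q'$. Let $n\ge 1$ and $k\ge 0$ be integers. Let $\mathrm{Red}_n^{(k)}:[(k+1)n]\to[n]$ send each $i$ to the element of $[n]$ congruent to $i$ mod $n$, and put $\mathrm{Red}_n^{(k)}(\overline i)=\overline{\mathrm{Red}_n^{(k)}(i)}$. For a partition $\pi$ of $[(k+1)n]$ or of $\overline{[(k+1)n]}$, let $\mathrm{Red}_n^{(k)}(\pi)=\{\mathrm{Red}_n^{(k)}(V): V \text{ a block of } \pi\}$, a collection of subsets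 of $[n]$ or of $\overline{[n]}$. Let $NC^{(k)}(n)$, the set of non-crossing partitions of type $k$, be the set of all $\pi\in NC^{(A)}((k+1)n)$ such that $\mathrm{Red}_n^{(k)}(\pi)$ is a non-crossing partition of $[n]$ and $\mathrm{Red}_n^{(k)}(\mathrm{Kr}(\pi))$ is a non-crossing partition of $\overline{[n]}$. Theorem. The map $\pi\mapsto\mathrm{Red}_n^{(k)}(\pi)$ from $NC^{(k)}(n)$ to $NC^{(A)}(n)$ is surjective, and each of its fibres has exactly $$\frac{1}{(k+1)n+1}\binom{(n+1)(k+1)}{k+1}$$ elements. -/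

import Mathlib

namespace NonCrossing

/-- `a` and `b` are linked in the partition `p`: they lie in the same block. -/
def Linked {X : Type*} [Fintype X] [DecidableEq X]
    (p : Finpartition (Finset.univ : Finset X)) (a b : X) : Prop :=
  ∃ V ∈ p.parts, a ∈ V ∧ b ∈ V

/-- A partition `p` of a totally ordered finite set is non-crossing if `a < b < c < d`,
`a ∼ c` and `b ∼ d` imply `a ∼ b`. -/
def IsNonCrossing {X : Type*} [Fintype X] [LinearOrder X]
    (p : Finpartition (Finset.univ : Finset X)) : Prop :=
  ∀ ⦃a b c d : X⦄, a < b → b < c → c < d → Linked p a c → Linked p b d → Linked p a b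

/-- The set of non-crossing partitions of `[m]`. The set `[m] = {1 < ⋯ < m}` is modelled by `Fin m`,
the point `i` of `[m]` being the element `i - 1` of `Fin m`. -/
abbrev NCA (m : ℕ) : Type :=
  {p : Finpartition (Finset.univ : Finset (Fin m)) // IsNonCrossing p}

/-- The set `[m] ∪ [m]‾` with the total order `1 < 1‾ < 2 < 2‾ < ⋯ < m < m‾`: the lexicographic
product of `[m]` with `false < true`, where `false` marks `[m]` and `true` marks the copy. -/
abbrev Doubled (m : ℕ) : Type := Fin m ×ₗ Bool

/-- The inclusion of `[m]` in `[m] ∪ [m]‾`. -/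
def plain {m : ℕ} (i : Fin m) : Doubled m := toLex (i, false)

/-- The bijection `i ↦ i‾` of `[m]` with its copy in `[m] ∪ [m]‾`. -/
def bar {m : ℕ} (i : Fin m) : Doubled m := toLex (i, true)

theorem plain_injective {m : ℕ} : Function.Injective (plain : Fin m → Doubled m) := by
  intro a b h
  simpa [plain] using h

theorem bar_injective {m : ℕ} : Function.Injective (bar : Fin m → Doubled m) := by
  intro a b h
  simpa [bar] using h

theorem plain_ne_bar {m : ℕ} (a b : Fin m) : plain a ≠ bar b := by
  simp [plain, bar]

/-- The partition `p ∪ q` of `[m] ∪ [m]‾`, where `p` is a partition of `[m]` and `q` is a partition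
of the copy `[m]‾` (which is identified with `[m]`). -/
def union {m : ℕ} (p q : Finpartition (Finset.univ : Finset (Fin m))) :
    Finpartition (Finset.univ : Finset (Doubled m)) :=
  Finpartition.ofExistsUnique
    (p.parts.image (Finset.image plain) ∪ q.parts.image (Finset.image bar))
    (fun _ _ => Finset.subset_univ _)
    (by
      intro z _
      obtain ⟨⟨i, b⟩, rfl⟩ := toLex.surjective z
      cases b
      · obtain ⟨V, hV, hi⟩ := p.exists_mem (Finset.mem_univ i)
        refine ⟨V.image plain, ⟨Finset.mem_union_left _ (Finset.mem_image_of_mem _ hV),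
          Finset.mem_image_of_mem plain hi⟩, ?_⟩
        rintro W ⟨hW, hiW⟩
        rcases Finset.mem_union.1 hW with hW | hW
        · obtain ⟨V', hV', rfl⟩ := Finset.mem_image.1 hW
          obtain ⟨j, hj, hji⟩ := Finset.mem_image.1 hiW
          obtain rfl : j = i := plain_injective hji
          rw [p.eq_of_mem_parts hV' hV hj hi]
        · obtain ⟨V', hV', rfl⟩ := Finset.mem_image.1 hW
          obtain ⟨j, hj, hji⟩ := Finset.mem_image.1 hiW
          exact absurd hji.symm (plain_ne_bar i j)
      · obtain ⟨V, hV, hi⟩ := q.exists_mem (Finset.mem_univ i)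
        refine ⟨V.image bar, ⟨Finset.mem_union_right _ (Finset.mem_image_of_mem _ hV),
          Finset.mem_image_of_mem bar hi⟩, ?_⟩
        rintro W ⟨hW, hiW⟩
        rcases Finset.mem_union.1 hW with hW | hW
        · obtain ⟨V', hV', rfl⟩ := Finset.mem_image.1 hW
          obtain ⟨j, hj, hji⟩ := Finset.mem_image.1 hiW
          exact absurd hji (plain_ne_bar j i)
        · obtain ⟨V', hV', rfl⟩ := Finset.mem_image.1 hW
          obtain ⟨j, hj, hji⟩ := Finset.mem_image.1 hiW
          obtain rfl : j = i := bar_injective hji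
          rw [q.eq_of_mem_parts hV' hV hj hi])
    (by
      intro h
      rcases Finset.mem_union.1 h with h | h
      · obtain ⟨V, hV, h⟩ := Finset.mem_image.1 h
        rw [Finset.image_eq_empty.1 h] at hV
        exact p.bot_notMem hV
      · obtain ⟨V, hV, h⟩ := Finset.mem_image.1 h
        rw [Finset.image_eq_empty.1 h] at hV
        exact q.bot_notMem hV)

theorem union_parts {m : ℕ} (p q : Finpartition (Finset.univ : Finset (Fin m))) :
    (union p q).parts =
      p.parts.image (Finset.image plain) ∪ q.parts.image (Finset.image bar) := rfl

theorem linked_union_plain {m : ℕ} (p q : Finpartition (Finset.univ : Finset (Fin m)))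
    (a b : Fin m) : Linked (union p q) (plain a) (plain b) ↔ Linked p a b := by
  simp [Linked, union_parts, or_and_right, exists_or, plain_injective.eq_iff,
    (plain_ne_bar _ _).symm]

theorem linked_union_bar {m : ℕ} (p q : Finpartition (Finset.univ : Finset (Fin m)))
    (a b : Fin m) : Linked (union p q) (bar a) (bar b) ↔ Linked q a b := by
  simp [Linked, union_parts, or_and_right, exists_or, bar_injective.eq_iff, plain_ne_bar]

theorem not_linked_union_plain_bar {m : ℕ} (p q : Finpartition (Finset.univ : Finset (Fin m)))
    (a b : Fin m) : ¬ Linked (union p q) (plain a) (bar b) := by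
  simp [Linked, union_parts, or_and_right, exists_or, plain_ne_bar, (plain_ne_bar _ _).symm]

theorem not_linked_union_bar_plain {m : ℕ} (p q : Finpartition (Finset.univ : Finset (Fin m)))
    (a b : Fin m) : ¬ Linked (union p q) (bar a) (plain b) := by
  simp [Linked, union_parts, or_and_right, exists_or, plain_ne_bar, (plain_ne_bar _ _).symm]

theorem plain_lt_plain {m : ℕ} (a b : Fin m) : plain a < plain b ↔ a < b := by
  simp [plain, Prod.Lex.toLex_lt_toLex]

theorem bar_lt_bar {m : ℕ} (a b : Fin m) : bar a < bar b ↔ a < b := by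
  simp [bar, Prod.Lex.toLex_lt_toLex]

theorem plain_lt_bar {m : ℕ} (a b : Fin m) : plain a < bar b ↔ a ≤ b := by
  simp [plain, bar, Prod.Lex.toLex_lt_toLex, le_iff_lt_or_eq]

theorem bar_lt_plain {m : ℕ} (a b : Fin m) : bar a < plain b ↔ a < b := by
  simp [plain, bar, Prod.Lex.toLex_lt_toLex]

theorem linked_symm {X : Type*} [Fintype X] [DecidableEq X]
    {p : Finpartition (Finset.univ : Finset X)} {a b : X} (h : Linked p a b) : Linked p b a := by
  obtain ⟨V, hV, ha, hb⟩ := h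
  exact ⟨V, hV, hb, ha⟩

/-- For every non-crossing partition `p` of `[m]` there is a biggest partition `q` of `[m]‾` such
that `p ∪ q` is non-crossing. The order of `Finpartition` is the reverse refinement order: `p ≤ q`
if every block of `p` is contained in a block of `q`. -/
theorem exists_isGreatest_kreweras {m : ℕ} (p : NCA m) :
    ∃ q, IsGreatest {q : Finpartition (Finset.univ : Finset (Fin m)) |
      IsNonCrossing (union p.1 q)} q := by
  classical
  let s : Setoid (Fin m) :=
    { r := fun x y => ∀ a b, Linked p.1 a b → ((x < a ↔ x < b) ↔ (y < a ↔ y < b))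
      iseqv :=
        { refl := fun _ _ _ _ => Iff.rfl
          symm := fun h a b hab => (h a b hab).symm
          trans := fun h h' a b hab => (h a b hab).trans (h' a b hab) } }
  have hs : ∀ x y, Linked (Finpartition.ofSetoid s) x y ↔
      ∀ a b, Linked p.1 a b → ((x < a ↔ x < b) ↔ (y < a ↔ y < b)) := by
    intro x y
    have h1 : y ∈ (Finpartition.ofSetoid s).part x ↔ s x y :=
      Finpartition.mem_part_ofSetoid_iff_rel
    rw [Finpartition.mem_part_iff_exists] at h1
    constructor
    · rintro ⟨V, hV, hx, hy⟩
      exact h1.1 ⟨V, hV, hy, hx⟩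
    · intro h
      obtain ⟨V, hV, hy, hx⟩ := h1.2 h
      exact ⟨V, hV, hx, hy⟩
  refine ⟨Finpartition.ofSetoid s, ?_, ?_⟩
  · intro a b c d hab hbc hcd hac hbd
    obtain ⟨⟨a, i⟩, rfl⟩ := toLex.surjective a
    obtain ⟨⟨b, j⟩, rfl⟩ := toLex.surjective b
    obtain ⟨⟨c, k⟩, rfl⟩ := toLex.surjective c
    obtain ⟨⟨d, l⟩, rfl⟩ := toLex.surjective d
    have e0 : ∀ x : Fin m, toLex (x, false) = plain x := fun _ => rfl
    have e1 : ∀ x : Fin m, toLex (x, true) = bar x := fun _ => rfl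
    cases i <;> cases j <;> cases k <;> cases l <;>
      simp only [e0, e1, plain_lt_plain, bar_lt_bar, plain_lt_bar, bar_lt_plain,
        linked_union_plain, linked_union_bar, not_linked_union_plain_bar,
        not_linked_union_bar_plain] at *
    · exact p.2 hab hbc hcd hac hbd
    · have := (hs _ _).1 hbd _ _ hac
      omega
    · have := (hs _ _).1 hac _ _ hbd
      omega
    · rw [hs] at hac hbd ⊢
      intro u v huv
      have h1 := hac u v huv
      have h2 := hbd u v huv
      omega
  · intro q hq V hV
    obtain ⟨x, hx⟩ := q.nonempty_of_mem_parts hV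
    obtain ⟨W, hW, hxW⟩ := (Finpartition.ofSetoid s).exists_mem (Finset.mem_univ x)
    refine ⟨W, hW, fun y hy => ?_⟩
    have hqxy : Linked q x y := ⟨V, hV, hx, hy⟩
    have hU1 : ∀ x y a b : Fin m, Linked q x y → Linked p.1 a b →
        ¬ (x < a ∧ a ≤ y ∧ y < b) := by
      rintro x y a b h1 h2 ⟨h3, h4, h5⟩
      exact not_linked_union_bar_plain p.1 q x a
        (hq ((bar_lt_plain x a).2 h3) ((plain_lt_bar a y).2 h4) ((bar_lt_plain y b).2 h5)
          ((linked_union_bar p.1 q x y).2 h1) ((linked_union_plain p.1 q a b).2 h2))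
    have hU2 : ∀ x y a b : Fin m, Linked q x y → Linked p.1 a b →
        ¬ (a ≤ x ∧ x < b ∧ b ≤ y) := by
      rintro x y a b h1 h2 ⟨h3, h4, h5⟩
      exact not_linked_union_plain_bar p.1 q a x
        (hq ((plain_lt_bar a x).2 h3) ((bar_lt_plain x b).2 h4) ((plain_lt_bar b y).2 h5)
          ((linked_union_plain p.1 q a b).2 h2) ((linked_union_bar p.1 q x y).2 h1))
    have hl : Linked (Finpartition.ofSetoid s) x y := by
      rw [hs]
      intro a b hab
      have h1 := hU1 x y a b hqxy hab
      have h2 := hU1 x y b a hqxy (linked_symm hab)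
      have h3 := hU1 y x a b (linked_symm hqxy) hab
      have h4 := hU1 y x b a (linked_symm hqxy) (linked_symm hab)
      have h5 := hU2 x y a b hqxy hab
      have h6 := hU2 x y b a hqxy (linked_symm hab)
      have h7 := hU2 y x a b (linked_symm hqxy) hab
      have h8 := hU2 y x b a (linked_symm hqxy) (linked_symm hab)
      omega
    obtain ⟨W', hW', hx', hy'⟩ := hl
    rwa [(Finpartition.ofSetoid s).eq_of_mem_parts hW hW' hxW hx']

/-- The Kreweras complement of a non-crossing partition `p` of `[m]`: the biggest partition `q`
of `[m]‾` such that `p ∪ q` is a non-crossing partition of `[m] ∪ [m]‾`. -/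
noncomputable def kr {m : ℕ} (p : NCA m) : Finpartition (Finset.univ : Finset (Fin m)) :=
  (exists_isGreatest_kreweras p).choose

theorem kr_isGreatest {m : ℕ} (p : NCA m) :
    IsGreatest {q : Finpartition (Finset.univ : Finset (Fin m)) |
      IsNonCrossing (union p.1 q)} (kr p) :=
  (exists_isGreatest_kreweras p).choose_spec

/-- The reduction mod `n` map `[(k+1)n] → [n]`, which sends `i` to its congruence class mod `n`. -/
def redPoint (n k : ℕ) (i : Fin ((k + 1) * n)) : Fin n := i.modNat

/-- The collection `{Red(V) | V a block of p}` of subsets of `[n]`. -/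
def redBlocks (n k : ℕ) (p : Finpartition (Finset.univ : Finset (Fin ((k + 1) * n)))) :
    Finset (Finset (Fin n)) :=
  p.parts.image (fun V => V.image (redPoint n k))

/-- The collection `F` of subsets of `[n]` is a non-crossing partition of `[n]`. -/
def IsNCPartition {n : ℕ} (F : Finset (Finset (Fin n))) : Prop :=
  ∃ q : NCA n, q.1.parts = F

/-- The mod `n` reduction property: both `Red(p)` and `Red(Kr(p))` are non-crossing partitions.
The copies `[(k+1)n]‾` and `[n]‾` are identified, as ordered sets, with `[(k+1)n]` and `[n]`. -/
def ReductionProperty (n k : ℕ) (p : NCA ((k + 1) * n)) : Prop :=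
  IsNCPartition (redBlocks n k p.1) ∧ IsNCPartition (redBlocks n k (kr p))

/-- The set of non-crossing partitions of type `k`. -/
abbrev NCK (k n : ℕ) : Type := {p : NCA ((k + 1) * n) // ReductionProperty n k p}

/-- The reduction map on non-crossing partitions of type `k`: `red p` is the non-crossing partition
of `[n]` whose set of blocks is `{Red(V) | V a block of p}`. -/
noncomputable def red {k n : ℕ} (p : NCK k n) : NCA n := p.2.1.choose

theorem red_parts {k n : ℕ} (p : NCK k n) : (red p).1.parts = redBlocks n k p.1.1 :=
  p.2.1.choose_spec

end NonCrossing

/-! Number `2 * N` endpoints from 0. The point `i` of `Fin N` sits in the gap before endpoint `2 * i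
+ 1`, and its copy in the gap before `2 * i + 2`. Tracing the boundaries of the thickened blocks
turns a non-crossing partition into a non-crossing pairing of the endpoints, and every pairing
arises once (`exists_pairingNC_eq`, `pairingNC_injective`). The arcs cut the half-plane into
regions: those at odd gaps are the blocks of the partition, those at even gaps the blocks of its
Kreweras complement (`linked_kr_pairingNC`), gap 0 being in the region of gap `2 * N`.

Let `ρ` be the pairing of `p`. The fibre over `p` consists of the pairings `f` of `2 * ((k + 1) *
n)` endpoints whose arcs project mod `2 * n` to arcs of `ρ` (`fibreEquiv`). For such `f` the regions
of `f` map onto regions of `ρ`, so both reductions are as required. Conversely, if `Red π = p` and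
`Red (Kr π)` is a partition, the latter refines `Kr p`, by a descent on crossing pairs
(`linked_kr_of_redBlocks`). So the regions of `f` lie over regions of `ρ`; as two regions of `ρ`
share at most one arc, the arcs of `f` lie over arcs of `ρ` (`periodic_of_le`).

To count these `f`, cut at the first arc. The admissible partners of an endpoint are spaced `2 * n`
apart, whatever `ρ` is, and the resulting convolution is solved by the coefficients of the powers of
`C = 1 + z C ^ (n + 1)` (`card_periodic_pairing`). The number is positive, which gives surjectivity.
-/

namespace NonCrossing

/-! ### Raney numbers -/

/-- The coefficient of `z ^ m` in `C(z) ^ r`, where `C = 1 + z C ^ p`. -/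
def raney (p : ℕ) : ℕ → ℕ → ℕ
  | 0, _ => 1
  | _ + 1, 0 => 0
  | m + 1, r + 1 => raney p (m + 1) r + raney p m (r + p)
termination_by m r => (m, r)

theorem raney_zero_left (p r : ℕ) : raney p 0 r = 1 := by rw [raney]

theorem raney_succ_zero (p m : ℕ) : raney p (m + 1) 0 = 0 := by rw [raney]

theorem raney_succ_succ (p m r : ℕ) :
    raney p (m + 1) (r + 1) = raney p (m + 1) r + raney p m (r + p) := by rw [raney]

/-- This is `C ^ r * C ^ s = C ^ (r + s)`, read off on coefficients. -/
theorem sum_raney_mul_raney (p m r s : ℕ) :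
    ∑ i ∈ Finset.range (m + 1), raney p i r * raney p (m - i) s = raney p m (r + s) := by
  induction m generalizing r with
  | zero => simp [raney_zero_left]
  | succ m ihm =>
    induction r with
    | zero =>
      rw [Finset.sum_range_succ']
      simp [raney_succ_zero, raney_zero_left]
    | succ r ihr =>
      rw [Finset.sum_range_succ'] at ihr ⊢
      simp only [raney_succ_succ, add_mul, Finset.sum_add_distrib, Nat.add_sub_add_right,
        raney_zero_left] at ihr ⊢
      rw [ihm, show r + 1 + s = r + s + 1 by ring, raney_succ_succ, ← ihr,
        show r + s + p = r + p + s by ring]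
      ring

theorem raney_mul_eq {p : ℕ} (hp : 0 < p) (m r : ℕ) :
    raney p m r * (p * m + r) = r * (p * m + r).choose m := by
  induction m generalizing r with
  | zero => simp [raney_zero_left]
  | succ m ihm =>
    induction r with
    | zero => simp [raney_succ_zero]
    | succ r ihr =>
      set Q := p * (m + 1) + r with hQ
      have hQ0 : 0 < Q := by positivity
      have h1 := ihm (r + p)
      rw [show p * m + (r + p) = Q by rw [hQ]; ring] at h1
      have h2 := Nat.add_one_mul_choose_eq Q m
      have h3 := Nat.choose_succ_right_eq Q m
      have hmQ : m ≤ Q := by rw [hQ]; nlinarith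
      obtain ⟨d, hd⟩ := Nat.exists_eq_add_of_le hmQ
      have hdd : Q - m = d := by omega
      rw [hdd] at h3
      rw [show p * (m + 1) + (r + 1) = Q + 1 by omega, raney_succ_succ]
      -- Both terms of the recursion have the same denominator `Q` in the closed form, so
      -- multiplying by `Q` makes the two induction hypotheses applicable at once.
      have h4 : (raney p (m + 1) r + raney p m (r + p)) * (m + 1) = (r + 1) * Q.choose m := by
        apply Nat.eq_of_mul_eq_mul_right hQ0
        calc _ = (raney p (m + 1) r * Q + raney p m (r + p) * Q) * (m + 1) := by ring
          _ = r * (Q.choose (m + 1) * (m + 1)) + (r + p) * Q.choose m * (m + 1) := by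
            rw [ihr, h1]; ring
          _ = Q.choose m * (r * (m + d) + (p * (m + 1) + r)) := by rw [h3]; ring
          _ = _ := by rw [← hd, ← hQ]; ring
      apply Nat.eq_of_mul_eq_mul_right (Nat.succ_pos m)
      calc _ = (raney p (m + 1) r + raney p m (r + p)) * (m + 1) * (Q + 1) := by
            rw [Nat.succ_eq_add_one]; ring
        _ = (r + 1) * ((Q + 1) * Q.choose m) := by rw [h4]; ring
        _ = _ := by rw [h2, Nat.succ_eq_add_one]; ring

theorem raney_one_eq (n m : ℕ) :
    (raney (n + 1) m 1 : ℚ) = 1 / ((m : ℚ) * n + 1) * (((n + 1) * m).choose m : ℚ) := by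
  have h1 := raney_mul_eq (Nat.succ_pos n) m 1
  have h2 := Nat.add_one_mul_choose_eq ((n + 1) * m) m
  have h3 := Nat.choose_succ_right_eq ((n + 1) * m + 1) m
  rw [show (n + 1) * m + 1 - m = n * m + 1 by rw [add_mul]; omega] at h3
  have h4 : raney (n + 1) m 1 * (n * m + 1) = ((n + 1) * m).choose m := by
    apply Nat.eq_of_mul_eq_mul_right (Nat.succ_pos ((n + 1) * m))
    rw [Nat.succ_eq_add_one]
    rw [one_mul] at h1
    calc _ = raney (n + 1) m 1 * ((n + 1) * m + 1) * (n * m + 1) := by ring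
      _ = ((n + 1) * m + 1) * ((n + 1) * m).choose m := by rw [h1, ← h3, ← h2]
      _ = _ := by ring
  have h5 : (raney (n + 1) m 1 : ℚ) * (n * m + 1) = ((n + 1) * m).choose m := by exact_mod_cast h4
  have h6 : ((m : ℚ) * n + 1) ≠ 0 := by positivity
  rw [← h5]
  field_simp

/-! ### Coloured non-crossing pairings -/

/-- `f` is a non-crossing pairing of the interval `[g, g + 2 * L)` which matches even with odd
numbers, such that any two matched numbers `x`, `y` satisfy `C x y`. -/
structure IsPairing (C : ℕ → ℕ → Prop) (g L : ℕ) (f : ℕ → ℕ) : Prop where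
  invol : ∀ x, f (f x) = x
  fix : ∀ x, x < g ∨ g + 2 * L ≤ x → f x = x
  color : ∀ x, g ≤ x → x < g + 2 * L → C x (f x)
  odd : ∀ x, g ≤ x → x < g + 2 * L → (f x + x) % 2 = 1
  nc : ∀ x y, x < y → y < f x → x < f y ∧ f y < f x

namespace IsPairing

variable {C : ℕ → ℕ → Prop} {g L : ℕ} {f : ℕ → ℕ}

theorem mem (h : IsPairing C g L f) {x : ℕ} (h1 : g ≤ x) (h2 : x < g + 2 * L) :
    g ≤ f x ∧ f x < g + 2 * L := by
  by_contra hn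
  have h3 := h.fix (f x) (by omega)
  rw [h.invol] at h3
  have := h.odd x h1 h2
  omega

theorem restrict (h : IsPairing C g L f) {a l : ℕ} (ha : g ≤ a) (hl : a + 2 * l ≤ g + 2 * L)
    (hm : ∀ x, a ≤ x → x < a + 2 * l → a ≤ f x ∧ f x < a + 2 * l) :
    IsPairing C a l (fun x => if a ≤ x ∧ x < a + 2 * l then f x else x) where
  invol x := by
    have := hm x
    have := h.invol x
    grind
  fix x hx := by grind
  color x h1 h2 := by
    rw [if_pos ⟨h1, h2⟩]
    exact h.color x (by omega) (by omega)
  odd x h1 h2 := by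
    rw [if_pos ⟨h1, h2⟩]
    exact h.odd x (by omega) (by omega)
  nc x y := by
    have := h.nc x y
    have := hm x
    have := hm y
    grind

end IsPairing

/-- The pairing of `[g, ∞)` in which `g` is matched with `g + 2 * i + 1`, and which is `f₁` between
the two and `f₂` after them. -/
def glue (g i : ℕ) (f₁ f₂ : ℕ → ℕ) (x : ℕ) : ℕ :=
  if x = g then g + 2 * i + 1 else if x = g + 2 * i + 1 then g
  else if x < g + 2 * i + 1 then f₁ x else f₂ x

theorem IsPairing.glue {C : ℕ → ℕ → Prop} (hC : ∀ x y, C x y → C y x) {g i l : ℕ}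
    {f₁ f₂ : ℕ → ℕ} (hi : C g (g + 2 * i + 1)) (h₁ : IsPairing C (g + 1) i f₁)
    (h₂ : IsPairing C (g + 2 * i + 2) l f₂) :
    IsPairing C g (i + l + 1) (glue g i f₁ f₂) where
  invol x := by
    have := h₁.invol x
    have := h₂.invol x
    have := h₁.mem (x := x)
    have := h₂.mem (x := x)
    have := h₁.fix x
    have := h₂.fix x
    grind [NonCrossing.glue]
  fix x hx := by
    have := h₁.fix x
    have := h₂.fix x
    grind [NonCrossing.glue]
  color x h1 h2 := by
    have := h₁.color x
    have := h₂.color x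
    grind [NonCrossing.glue]
  odd x h1 h2 := by
    have := h₁.odd x
    have := h₂.odd x
    grind [NonCrossing.glue]
  nc x y := by
    have := h₁.nc x y
    have := h₂.nc x y
    have := h₁.mem (x := x)
    have := h₂.mem (x := x)
    have := h₁.mem (x := y)
    have := h₂.mem (x := y)
    have := h₁.fix x
    have := h₂.fix x
    have := h₁.fix y
    have := h₂.fix y
    grind [NonCrossing.glue]

/-- Cutting a non-crossing pairing at the first pair. -/
noncomputable def pairingEquiv {C : ℕ → ℕ → Prop} (hC : ∀ x y, C x y → C y x) (g L : ℕ) :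
    (Σ i : {i : Fin (L + 1) // C g (g + 2 * i + 1)},
      {f // IsPairing C (g + 1) i.1 f} × {f // IsPairing C (g + 2 * i.1 + 2) (L - i.1) f}) ≃
    {f // IsPairing C g (L + 1) f} :=
  Equiv.ofBijective
    (fun t => ⟨glue g t.1.1 t.2.1.1 t.2.2.1, by
      have h := IsPairing.glue hC t.1.2 t.2.1.2 t.2.2.2
      have := t.1.1.2
      rwa [show (t.1.1 : ℕ) + (L - t.1.1) + 1 = L + 1 by omega] at h⟩) (by
    constructor
    · rintro ⟨⟨i, hi⟩, ⟨a, ha⟩, ⟨b, hb⟩⟩ ⟨⟨j, hj⟩, ⟨c, hc⟩, ⟨d, hd⟩⟩ h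
      have h' : ∀ x, glue g i a b x = glue g j c d x := fun x =>
        congrFun (congrArg Subtype.val h) x
      obtain rfl : i = j := by
        have := h' g
        simp only [glue, if_true] at this
        exact Fin.ext (by omega)
      obtain rfl : a = c := by
        funext x
        have := h' x
        have := ha.fix x
        have := hc.fix x
        grind [glue]
      obtain rfl : b = d := by
        funext x
        have := h' x
        have := hb.fix x
        have := hd.fix x
        grind [glue]
      rfl
    · rintro ⟨f, hf⟩
      have hm := hf.mem (x := g) le_rfl (by omega)
      have ho := hf.odd g le_rfl (by omega)
      have hc := hf.color g le_rfl (by omega)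
      obtain ⟨i, hi⟩ : ∃ i, f g = g + 2 * i + 1 := ⟨(f g - g) / 2, by omega⟩
      have hiL : i < L + 1 := by omega
      have hfi : f (g + 2 * i + 1) = g := by rw [← hi, hf.invol]
      have hm1 : ∀ x, g + 1 ≤ x → x < g + 1 + 2 * i → g + 1 ≤ f x ∧ f x < g + 1 + 2 * i := by
        intro x h1 h2
        have := hf.nc g x (by omega) (by omega)
        omega
      -- If `f x` fell under the first arc, so would `x = f (f x)`.
      have hm2 : ∀ x, g + 2 * i + 2 ≤ x → x < g + 2 * i + 2 + 2 * (L - i) →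
          g + 2 * i + 2 ≤ f x ∧ f x < g + 2 * i + 2 + 2 * (L - i) := by
        intro x h1 h2
        have h3 := hf.mem (x := x) (by omega) (by omega)
        have h4 := hf.nc g (f x)
        have h5 := hf.invol x
        have h6 : f x ≠ g := by
          intro h6
          rw [h6] at h5
          omega
        have h7 : f x ≠ g + 2 * i + 1 := by
          intro h6
          rw [h6] at h5
          omega
        omega
      refine ⟨⟨⟨⟨i, hiL⟩, by rwa [hi] at hc⟩, ⟨_, hf.restrict (a := g + 1) (l := i) (by omega)
        (by omega) hm1⟩, ⟨_, hf.restrict (a := g + 2 * i + 2) (l := L - i) (by omega)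
        (by omega) hm2⟩⟩, Subtype.ext (funext fun x => ?_)⟩
      have := hf.fix x
      simp only [glue]
      grind)

/-- Pairings are the identity off their interval, so that there is exactly one empty pairing and
counting functions counts pairings. -/
theorem isPairing_zero {C : ℕ → ℕ → Prop} {g : ℕ} {f : ℕ → ℕ} : IsPairing C g 0 f ↔ f = id := by
  constructor
  · intro h
    funext x
    exact h.fix x (by omega)
  · rintro rfl
    constructor <;> simp <;> omega

theorem finite_pairing {C : ℕ → ℕ → Prop} (hC : ∀ x y, C x y → C y x) (g L : ℕ) :
    Finite {f // IsPairing C g L f} := by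
  induction L using Nat.strong_induction_on generalizing g with
  | _ L ih =>
    cases L with
    | zero => simp only [isPairing_zero]; infer_instance
    | succ L =>
      have h1 : ∀ i : Fin (L + 1), Finite {f // IsPairing C (g + 1) i f} := fun i => ih _ i.2 _
      have h2 : ∀ i : Fin (L + 1), Finite {f // IsPairing C (g + 2 * i + 2) (L - i) f} :=
        fun i => ih _ (by omega) _
      exact Finite.of_equiv _ (pairingEquiv hC g L)

-- The Catalan recursion, restricted to the partners of `g` that the colours allow.
open scoped Classical in
theorem card_pairing_succ {C : ℕ → ℕ → Prop} (hC : ∀ x y, C x y → C y x) (g L : ℕ) :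
    Nat.card {f // IsPairing C g (L + 1) f} = ∑ i ∈ Finset.range (L + 1),
      if C g (g + 2 * i + 1) then Nat.card {f // IsPairing C (g + 1) i f} *
        Nat.card {f // IsPairing C (g + 2 * i + 2) (L - i) f} else 0 := by
  have h1 := fun g L => finite_pairing hC g L
  have : Fintype {i : Fin (L + 1) // C g (g + 2 * i + 1)} := Fintype.ofFinite _
  rw [← Nat.card_congr (pairingEquiv hC g L), Nat.card_sigma, Finset.sum_range, ← Finset.sum_filter,
    Finset.sum_subtype (F := this) (p := fun i : Fin (L + 1) => C g (g + 2 * i + 1)) _ (by simp)]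
  simp [Nat.card_prod]

/-! ### Regions of the arc diagram -/

/-- No pair of the pairing `f` separates the gap before `u` from the gap before `v`. -/
def SameRegion (f : ℕ → ℕ) (u v : ℕ) : Prop :=
  ∀ x, ((x < u ↔ f x < u) ↔ (x < v ↔ f x < v))

theorem SameRegion.refl (f : ℕ → ℕ) (u : ℕ) : SameRegion f u u := fun _ => Iff.rfl

theorem SameRegion.symm {f : ℕ → ℕ} {u v : ℕ} (h : SameRegion f u v) : SameRegion f v u :=
  fun x => (h x).symm

theorem SameRegion.trans {f : ℕ → ℕ} {u v w : ℕ} (h : SameRegion f u v) (h' : SameRegion f v w) :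
    SameRegion f u w := fun x => (h x).trans (h' x)

namespace IsPairing

variable {C : ℕ → ℕ → Prop} {n : ℕ} {f : ℕ → ℕ}

theorem lt (h : IsPairing C 0 n f) {x : ℕ} (hx : x < 2 * n) : f x < 2 * n := by
  have := h.mem (x := x) (by omega) (by omega)
  omega

theorem sameRegion_zero (h : IsPairing C 0 n f) : SameRegion f 0 (2 * n) := by
  intro x
  have := h.fix x
  have := h.lt (x := x)
  omega

/-- The two gaps lie beside the ends of one arc, on the same side of it, and an arc separating them
would cross it. The step from `x` to `f x + 1` thus walks along the boundary of a region; later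
inductions repeat it. -/
theorem sameRegion_partner (h : IsPairing C 0 n f) {x : ℕ} (hx : x < 2 * n) :
    SameRegion f x (f x + 1) := by
  intro z
  have h1 := h.nc x z
  have h2 := h.nc x (f z)
  have h3 := h.nc (f x) z
  have h4 := h.nc (f x) (f z)
  have h5 := h.invol x
  have h6 := h.invol z
  have h7 := h.odd x (by omega) (by omega)
  rw [h6] at h2 h4
  rw [h5] at h3 h4
  by_cases hzx : z = x
  · subst hzx
    omega
  by_cases hzf : z = f x
  · subst hzf
    omega
  have h8 : f z ≠ x := by
    intro h8
    rw [h8] at h6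
    omega
  have h9 : f z ≠ f x := by
    intro h8
    rw [h8] at h6
    omega
  omega

/-- The gaps before `u` and before `w > u` lie in the same region only if the partner of `u` lies
in between. -/
theorem partner_mem (h : IsPairing C 0 n f) {u w : ℕ} (huw : u < w) (hw : w ≤ 2 * n)
    (hr : SameRegion f u w) : u < f u ∧ f u < w := by
  have h1 := hr u
  have h2 := h.odd u (by omega) (by omega)
  omega

theorem partner_notMem (h : IsPairing C 0 n f) {u w : ℕ} (huw : w < u) (hu : u < 2 * n)
    (hr : SameRegion f u w) : u < f u ∨ f u < w := by
  have h1 := hr u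
  have h2 := h.odd u (by omega) (by omega)
  omega

/-- If the gaps before `u` and before `v` lie in the same region, they have the same parity. -/
theorem sameRegion_parity (h : IsPairing C 0 n f) {u v : ℕ} (huv : u ≤ v) (hv : v ≤ 2 * n)
    (hr : SameRegion f u v) : (u + v) % 2 = 0 := by
  obtain ⟨d, hd⟩ := Nat.exists_eq_add_of_le huv
  induction d using Nat.strong_induction_on generalizing u with
  | _ d ih =>
    rcases Nat.eq_zero_or_pos d with h0 | h0
    · omega
    · have h1 := h.partner_mem (by omega) hv hr
      have h2 := h.odd u (by omega) (by omega)
      have := ih (v - (f u + 1)) (by omega) (by omega)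
        ((h.sameRegion_partner (by omega)).symm.trans hr) (by omega)
      omega

end IsPairing

/-! ### Periodic colours -/

/-- The colour condition imposed by the pairing `ρ` of `[0, 2 * n)`, repeated periodically. -/
def Periodic (n : ℕ) (ρ : ℕ → ℕ) (x y : ℕ) : Prop := y % (2 * n) = ρ (x % (2 * n))

/-- The relation `SameRegion ρ` on gaps, repeated periodically. -/
def PeriodicRegion (n : ℕ) (ρ : ℕ → ℕ) (u v : ℕ) : Prop :=
  SameRegion ρ (u % (2 * n)) (v % (2 * n))

namespace PeriodicRegion

theorem refl (n : ℕ) (ρ : ℕ → ℕ) (u : ℕ) : PeriodicRegion n ρ u u := SameRegion.refl _ _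

theorem symm {n : ℕ} {ρ : ℕ → ℕ} {u v : ℕ} (h : PeriodicRegion n ρ u v) :
    PeriodicRegion n ρ v u := SameRegion.symm h

theorem trans {n : ℕ} {ρ : ℕ → ℕ} {u v w : ℕ} (h : PeriodicRegion n ρ u v)
    (h' : PeriodicRegion n ρ v w) : PeriodicRegion n ρ u w := SameRegion.trans h h'

theorem of_mod_eq {n : ℕ} {ρ : ℕ → ℕ} {u v : ℕ} (h : u % (2 * n) = v % (2 * n)) :
    PeriodicRegion n ρ u v := by
  unfold PeriodicRegion
  rw [h]
  exact SameRegion.refl _ _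

end PeriodicRegion

namespace IsPairing

variable {D : ℕ → ℕ → Prop} {n : ℕ} {ρ : ℕ → ℕ}

theorem periodic_symm (h : IsPairing D 0 n ρ) {x y : ℕ} (hxy : Periodic n ρ x y) :
    Periodic n ρ y x := by
  unfold Periodic at *
  rw [hxy, h.invol]

/-- The representative `2 * n` is allowed besides 0, since both gaps lie in one region of `ρ`; the
gap of the last barred point needs it. -/
theorem periodicRegion_iff (h : IsPairing D 0 n ρ) {u v a b : ℕ}
    (ha : a ≤ 2 * n) (hb : b ≤ 2 * n) (hu : u % (2 * n) = a % (2 * n))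
    (hv : v % (2 * n) = b % (2 * n)) :
    PeriodicRegion n ρ u v ↔ SameRegion ρ a b := by
  have key : ∀ a, a ≤ 2 * n → SameRegion ρ (a % (2 * n)) a := by
    intro a ha
    rcases ha.lt_or_eq with ha | rfl
    · rw [Nat.mod_eq_of_lt ha]
      exact SameRegion.refl _ _
    · rw [Nat.mod_self]
      exact h.sameRegion_zero
  unfold PeriodicRegion
  rw [hu, hv]
  exact ⟨fun h' => ((key a ha).symm.trans h').trans (key b hb),
    fun h' => ((key a ha).trans h').trans (key b hb).symm⟩

theorem periodicRegion_right (hn : 0 < n) (h : IsPairing D 0 n ρ) {x y : ℕ}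
    (hxy : Periodic n ρ x y) : PeriodicRegion n ρ x (y + 1) := by
  have hx : x % (2 * n) < 2 * n := Nat.mod_lt _ (by omega)
  have hy : y % (2 * n) < 2 * n := Nat.mod_lt _ (by omega)
  rw [h.periodicRegion_iff (a := x % (2 * n)) (b := y % (2 * n) + 1) (by omega) (by omega)
    (by simp) (by simp), hxy]
  exact h.sameRegion_partner hx

theorem periodicRegion_left (hn : 0 < n) (h : IsPairing D 0 n ρ) {x y : ℕ}
    (hxy : Periodic n ρ x y) : PeriodicRegion n ρ (x + 1) y :=
  (h.periodicRegion_right hn (h.periodic_symm hxy)).symm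

/-- The partners of `g` to its right, with respect to the periodic repetition of `ρ`. -/
theorem exists_step (hn : 0 < n) (h : IsPairing D 0 n ρ) (g : ℕ) :
    ∃ e, 0 < e ∧ e ≤ n ∧ (∀ i, Periodic n ρ g (g + 2 * i + 1) ↔ ∃ s, i + 1 = e + n * s) ∧
      ∀ d, 0 < d → PeriodicRegion n ρ g (g + d) → 2 * e ≤ d := by
  set a := g % (2 * n) with ha
  have ha2 : a < 2 * n := Nat.mod_lt _ (by omega)
  obtain ⟨q, hq⟩ : ∃ q, g = 2 * (n * q) + a :=
    ⟨g / (2 * n), by rw [ha, ← mul_assoc]; exact (Nat.div_add_mod g (2 * n)).symm⟩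
  have hb := h.lt ha2
  have hodd := h.odd a (by omega) (by omega)
  set b := ρ a with hbdef
  have hmod : ∀ y c, c < 2 * n → (y % (2 * n) = c ↔ ∃ r, y = 2 * (n * r) + c) := by
    intro y c hc
    constructor
    · rintro rfl
      exact ⟨y / (2 * n), by rw [← mul_assoc]; exact (Nat.div_add_mod y (2 * n)).symm⟩
    · rintro ⟨r, rfl⟩
      rw [← mul_assoc, Nat.mul_add_mod, Nat.mod_eq_of_lt hc]
  -- The gap `g + 2 * e` is the one just after the first partner of `g` to its right. This partner
  -- is in the same period as `g` if `a < b` (`t = 0`), in the next one otherwise (`t = 1`).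
  obtain ⟨e, t, ht, he⟩ : ∃ e t, t ≤ 1 ∧ a + 2 * e = b + 1 + 2 * (n * t) ∧ 0 < e ∧ e ≤ n := by
    rcases lt_or_gt_of_ne (show a ≠ b by omega) with hab | hab
    · exact ⟨(b + 1 - a) / 2, 0, by omega, by omega, by omega, by omega⟩
    · exact ⟨(2 * n + b + 1 - a) / 2, 1, by omega, by omega, by omega, by omega⟩
  refine ⟨e, he.2.1, he.2.2, fun i => ?_, fun d hd hr => ?_⟩
  · unfold Periodic
    rw [← ha, ← hbdef, hmod _ _ hb]
    constructor
    · rintro ⟨r, hr⟩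
      have hle : q + t ≤ r := by
        by_contra hlt
        have h1 : n * (r + 1) ≤ n * (q + t) := Nat.mul_le_mul_left _ (by omega)
        rw [mul_add, mul_add] at h1
        omega
      obtain ⟨s, rfl⟩ := Nat.exists_eq_add_of_le hle
      refine ⟨s, ?_⟩
      have := mul_add n (q + t) s
      have := mul_add n q t
      omega
    · rintro ⟨s, hs⟩
      refine ⟨q + t + s, ?_⟩
      have := mul_add n (q + t) s
      have := mul_add n q t
      omega
  · by_cases hd2 : 2 * n ≤ d
    · omega
    -- Either the second gap is in the same period, and the partner of `a` lies between the gaps, or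
    -- it wraps around to before `a`, and the partner lies outside the stretch from there to `a`. In
    -- both cases the walk from `g` to `g + d` has passed the partner.
    rcases Nat.lt_or_ge (a + d) (2 * n + 1) with hlt | hge
    · rw [h.periodicRegion_iff (a := a) (b := a + d) (by omega) (by omega) (by simp [ha])
        (by simp [ha])] at hr
      have := h.partner_mem (by omega) (by omega) hr
      have ht0 : t = 0 := by
        by_contra ht1
        obtain rfl : t = 1 := by omega
        omega
      subst ht0
      omega
    · rw [h.periodicRegion_iff (a := a) (b := a + d - 2 * n) (by omega) (by omega) (by simp [ha])
        (by
          rw [← Nat.mod_eq_sub_mod (by omega)]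
          simp [ha])] at hr
      have := h.partner_notMem (by omega) (by omega) hr
      interval_cases t <;> omega

end IsPairing

/-! ### Counting the pairings that respect the colours -/

open Classical in
/-- The number of non-crossing pairings of `[g, g + 2 * L)` that respect the colours of `ρ`. -/
theorem card_periodic_pairing {D : ℕ → ℕ → Prop} {n : ℕ} {ρ : ℕ → ℕ} (hn : 0 < n)
    (h : IsPairing D 0 n ρ) (g L : ℕ) :
    Nat.card {f // IsPairing (Periodic n ρ) g L f} =
      if PeriodicRegion n ρ g (g + 2 * L) then raney (n + 1) (L / n) (L % n + 1) else 0 := by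
  induction L using Nat.strong_induction_on generalizing g with
  | _ L ih =>
    cases L with
    | zero => simp [isPairing_zero, PeriodicRegion.refl, raney_zero_left]
    | succ L =>
      rw [card_pairing_succ (fun x y => h.periodic_symm)]
      obtain ⟨e, he0, hen, hstep, hmin⟩ := h.exists_step hn g
      have hsum : ∀ i ∈ Finset.range (L + 1),
          (if Periodic n ρ g (g + 2 * i + 1) then
            Nat.card {f // IsPairing (Periodic n ρ) (g + 1) i f} *
            Nat.card {f // IsPairing (Periodic n ρ) (g + 2 * i + 2) (L - i) f} else 0) =
          if PeriodicRegion n ρ g (g + 2 * (L + 1)) then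
            if ∃ s, i + 1 = e + n * s then raney (n + 1) (i / n) (i % n + 1) *
              raney (n + 1) ((L - i) / n) ((L - i) % n + 1) else 0 else 0 := by
        intro i hi
        have hi := Finset.mem_range.1 hi
        rw [ih i (by omega), ih (L - i) (by omega),
          show g + 2 * i + 2 + 2 * (L - i) = g + 2 * (L + 1) by omega,
          show g + 1 + 2 * i = g + 2 * i + 1 by ring, ← hstep]
        -- For an admissible first arc the inner interval always begins and ends in one region; the
        -- outer interval does so exactly when the whole interval does.
        by_cases hc : Periodic n ρ g (g + 2 * i + 1)
        · have h1 := h.periodicRegion_left hn hc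
          have h2 := h.periodicRegion_right hn hc
          have h3 : PeriodicRegion n ρ (g + 2 * i + 2) (g + 2 * (L + 1)) ↔
              PeriodicRegion n ρ g (g + 2 * (L + 1)) :=
            ⟨fun h' => h2.trans h', fun h' => h2.symm.trans h'⟩
          simp [hc, h1, h3]
        · simp [hc]
      rw [Finset.sum_congr rfl hsum]
      split_ifs with hr
      · have hle := hmin _ (by omega) hr
        obtain ⟨t, ht⟩ := Nat.exists_eq_add_of_le (show e ≤ L + 1 by omega)
        obtain ⟨j, r, hr0, hjr⟩ : ∃ j r, r < n ∧ t = n * j + r :=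
          ⟨t / n, t % n, Nat.mod_lt _ hn, (Nat.div_add_mod t n).symm⟩
        have hdm : ∀ q x, x < n → (n * q + x) / n = q ∧ (n * q + x) % n = x := by
          intro q x hx
          rw [Nat.mul_add_div hn, Nat.div_eq_of_lt hx, Nat.mul_add_mod, Nat.mod_eq_of_lt hx]
          simp
        have hre : ∑ i ∈ Finset.range (L + 1),
            (if ∃ s, i + 1 = e + n * s then raney (n + 1) (i / n) (i % n + 1) *
              raney (n + 1) ((L - i) / n) ((L - i) % n + 1) else 0) =
            ∑ s ∈ Finset.range (j + 1), raney (n + 1) s e * raney (n + 1) (j - s) (r + 1) := by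
          rw [← Finset.sum_filter]
          symm
          apply Finset.sum_bij (fun s _ => n * s + (e - 1))
          · intro s hs
            have hs := Finset.mem_range.1 hs
            have : n * s ≤ n * j := Nat.mul_le_mul_left _ (by omega)
            simp only [Finset.mem_filter, Finset.mem_range]
            exact ⟨by omega, s, by omega⟩
          · intro s _ s' _ hss
            exact Nat.eq_of_mul_eq_mul_left hn (by omega)
          · intro i hi
            simp only [Finset.mem_filter, Finset.mem_range] at hi
            obtain ⟨hi, s, hs⟩ := hi
            refine ⟨s, ?_, by omega⟩
            rw [Finset.mem_range]
            by_contra hlt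
            have : n * (j + 1) ≤ n * s := Nat.mul_le_mul_left _ (by omega)
            rw [mul_add] at this
            omega
          · intro s hs
            have hs := Finset.mem_range.1 hs
            obtain ⟨j', rfl⟩ := Nat.exists_eq_add_of_le (show s ≤ j by omega)
            rw [mul_add] at hjr
            rw [show L - (n * s + (e - 1)) = n * j' + r by omega, (hdm _ _ hr0).1, (hdm _ _ hr0).2,
              (hdm s (e - 1) (by omega)).1, (hdm s (e - 1) (by omega)).2,
              show s + j' - s = j' by omega, show e - 1 + 1 = e by omega]
        rw [hre, sum_raney_mul_raney]
        -- The convolution is `raney (n + 1) j (e + r + 1)`. For `r + e = n` the recursion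
        -- identifies it with `raney (n + 1) (j + 1) 1`. For `r + e > n` the region of `g` would
        -- recur after `2 * (r + e - n) < 2 * e`, against the minimality of `e`.
        rcases lt_trichotomy (r + e) n with hlt | heq | hgt
        · rw [show L + 1 = n * j + (r + e) by omega, (hdm _ _ hlt).1, (hdm _ _ hlt).2]
          congr 1
          ring
        · rw [show L + 1 = n * (j + 1) + 0 by rw [mul_add]; omega, (hdm _ _ hn).1, (hdm _ _ hn).2,
            raney_succ_succ, raney_succ_zero, zero_add]
          congr 1
          omega
        · exfalso
          have h1 := hmin (2 * (r + e - n)) (by omega) (hr.trans (PeriodicRegion.of_mod_eq ?_))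
          · omega
          · rw [show g + 2 * (L + 1) = g + 2 * (r + e - n) + 2 * n * (j + 1) by
              have := mul_add n j 1
              rw [mul_assoc]
              omega]
            simp
      · simp

/-! ### Partitions as relations, and the Kreweras complement -/

theorem linked_iff_mem_part {X : Type*} [Fintype X] [DecidableEq X]
    {p : Finpartition (Finset.univ : Finset X)} {x y : X} : Linked p x y ↔ y ∈ p.part x := by
  rw [Finpartition.mem_part_iff_exists]
  constructor
  · rintro ⟨V, hV, hx, hy⟩
    exact ⟨V, hV, hy, hx⟩
  · rintro ⟨V, hV, hy, hx⟩
    exact ⟨V, hV, hx, hy⟩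

theorem linked_refl {X : Type*} [Fintype X] [DecidableEq X]
    (p : Finpartition (Finset.univ : Finset X)) (x : X) : Linked p x x :=
  linked_iff_mem_part.2 (p.mem_part (Finset.mem_univ x))

theorem linked_trans {X : Type*} [Fintype X] [DecidableEq X]
    {p : Finpartition (Finset.univ : Finset X)} {x y z : X} (h : Linked p x y)
    (h' : Linked p y z) : Linked p x z := by
  obtain ⟨V, hV, hx, hy⟩ := h
  obtain ⟨W, hW, hy', hz⟩ := h'
  obtain rfl := p.eq_of_mem_parts hV hW hy hy'
  exact ⟨V, hV, hx, hz⟩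

theorem part_mem_parts {X : Type*} [Fintype X] [DecidableEq X]
    (p : Finpartition (Finset.univ : Finset X)) (x : X) : p.part x ∈ p.parts :=
  p.part_mem.2 (Finset.mem_univ x)

theorem parts_eq_image_part {X : Type*} [Fintype X] [DecidableEq X]
    (p : Finpartition (Finset.univ : Finset X)) : p.parts = Finset.univ.image p.part := by
  ext V
  simp only [Finset.mem_image, Finset.mem_univ, true_and]
  constructor
  · intro hV
    obtain ⟨x, hx⟩ := p.nonempty_of_mem_parts hV
    exact ⟨x, p.part_eq_of_mem hV hx⟩
  · rintro ⟨x, rfl⟩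
    exact part_mem_parts p x

theorem finpartition_ext_linked {X : Type*} [Fintype X] [DecidableEq X]
    {p q : Finpartition (Finset.univ : Finset X)} (h : ∀ x y, Linked p x y ↔ Linked q x y) :
    p = q := by
  have : p.part = q.part := by
    funext x
    ext y
    rw [← linked_iff_mem_part, ← linked_iff_mem_part, h]
  ext1
  rw [parts_eq_image_part, parts_eq_image_part, this]

theorem linked_ofSetoid {X : Type*} [Fintype X] [DecidableEq X] (s : Setoid X)
    [DecidableRel s.r] (x y : X) : Linked (Finpartition.ofSetoid s) x y ↔ s x y := by
  rw [linked_iff_mem_part, Finpartition.mem_part_ofSetoid_iff_rel]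

/-- Two barred points may share a block exactly when no linked pair separates them: a separating
pair gives a crossing, and non-separation is itself an equivalence relation whose union with `p` is
non-crossing, hence lies below the greatest one. -/
theorem linked_kr {m : ℕ} (p : NCA m) (x y : Fin m) :
    Linked (kr p) x y ↔ ∀ a b, Linked p.1 a b → ((x < a ↔ x < b) ↔ (y < a ↔ y < b)) := by
  classical
  obtain ⟨hq, hmax⟩ := kr_isGreatest p
  constructor
  · have hU1 : ∀ x y a b : Fin m, Linked (kr p) x y → Linked p.1 a b →
        ¬ (x < a ∧ a ≤ y ∧ y < b) := by
      rintro x y a b h1 h2 ⟨h3, h4, h5⟩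
      exact not_linked_union_bar_plain p.1 (kr p) x a
        (hq ((bar_lt_plain x a).2 h3) ((plain_lt_bar a y).2 h4) ((bar_lt_plain y b).2 h5)
          ((linked_union_bar p.1 _ x y).2 h1) ((linked_union_plain p.1 _ a b).2 h2))
    have hU2 : ∀ x y a b : Fin m, Linked (kr p) x y → Linked p.1 a b →
        ¬ (a ≤ x ∧ x < b ∧ b ≤ y) := by
      rintro x y a b h1 h2 ⟨h3, h4, h5⟩
      exact not_linked_union_plain_bar p.1 (kr p) a x
        (hq ((plain_lt_bar a x).2 h3) ((bar_lt_plain x b).2 h4) ((plain_lt_bar b y).2 h5)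
          ((linked_union_plain p.1 _ a b).2 h2) ((linked_union_bar p.1 _ x y).2 h1))
    intro hxy a b hab
    have h1 := hU1 x y a b hxy hab
    have h2 := hU1 x y b a hxy (linked_symm hab)
    have h3 := hU1 y x a b (linked_symm hxy) hab
    have h4 := hU1 y x b a (linked_symm hxy) (linked_symm hab)
    have h5 := hU2 x y a b hxy hab
    have h6 := hU2 x y b a hxy (linked_symm hab)
    have h7 := hU2 y x a b (linked_symm hxy) hab
    have h8 := hU2 y x b a (linked_symm hxy) (linked_symm hab)
    omega
  · intro hxy
    let s : Setoid (Fin m) :=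
      { r := fun x y => ∀ a b, Linked p.1 a b → ((x < a ↔ x < b) ↔ (y < a ↔ y < b))
        iseqv :=
          { refl := fun _ _ _ _ => Iff.rfl
            symm := fun h a b hab => (h a b hab).symm
            trans := fun h h' a b hab => (h a b hab).trans (h' a b hab) } }
    have hs : ∀ x y, Linked (Finpartition.ofSetoid s) x y ↔
        ∀ a b, Linked p.1 a b → ((x < a ↔ x < b) ↔ (y < a ↔ y < b)) := linked_ofSetoid s
    have hmem : IsNonCrossing (union p.1 (Finpartition.ofSetoid s)) := by
      intro a b c d hab hbc hcd hac hbd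
      obtain ⟨⟨a, i⟩, rfl⟩ := toLex.surjective a
      obtain ⟨⟨b, j⟩, rfl⟩ := toLex.surjective b
      obtain ⟨⟨c, k⟩, rfl⟩ := toLex.surjective c
      obtain ⟨⟨d, l⟩, rfl⟩ := toLex.surjective d
      have e0 : ∀ x : Fin m, toLex (x, false) = plain x := fun _ => rfl
      have e1 : ∀ x : Fin m, toLex (x, true) = bar x := fun _ => rfl
      cases i <;> cases j <;> cases k <;> cases l <;>
        simp only [e0, e1, plain_lt_plain, bar_lt_bar, plain_lt_bar, bar_lt_plain,
          linked_union_plain, linked_union_bar, not_linked_union_plain_bar,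
          not_linked_union_bar_plain] at *
      · exact p.2 hab hbc hcd hac hbd
      · have := (hs _ _).1 hbd _ _ hac
        omega
      · have := (hs _ _).1 hac _ _ hbd
        omega
      · rw [hs] at hac hbd ⊢
        intro u v huv
        have h1 := hac u v huv
        have h2 := hbd u v huv
        omega
    obtain ⟨V, hV, hx, hy⟩ := (hs x y).2 hxy
    obtain ⟨W, hW, hVW⟩ := hmax hmem hV
    exact ⟨W, hW, hVW hx, hVW hy⟩

/-! ### From pairings to non-crossing partitions -/

/-- An arc separating `u` from `w` would have `u`, `v` on one side and `w`, `z` on the other. One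
side is an interval and the other its complement, so the two pairs could not interlace. -/
theorem SameRegion.of_crossing {f : ℕ → ℕ} {u v w z : ℕ} (h : SameRegion f u v)
    (h' : SameRegion f w z) (hc : ¬ ((u < w ↔ u < z) ↔ (v < w ↔ v < z))) : SameRegion f u w := by
  intro t
  have h1 := h t
  have h2 := h' t
  omega

open Classical in
/-- The non-crossing partition of `[N]` defined by a pairing `f` of `[0, 2 * N)`. -/
noncomputable def pairingNC (N : ℕ) (f : ℕ → ℕ) : NCA N :=
  ⟨Finpartition.ofSetoid
    { r := fun i j : Fin N => SameRegion f (2 * i + 1) (2 * j + 1)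
      iseqv := ⟨fun _ => .refl _ _, fun h => h.symm, fun h h' => h.trans h'⟩ }, by
    intro a b c d hab hbc hcd hac hbd
    rw [linked_ofSetoid] at *
    exact SameRegion.of_crossing hac hbd (by omega)⟩

theorem linked_pairingNC {N : ℕ} {f : ℕ → ℕ} (i j : Fin N) :
    Linked (pairingNC N f).1 i j ↔ SameRegion f (2 * i + 1) (2 * j + 1) := by
  classical
  exact linked_ofSetoid _ _ _

theorem linked_kr_pairingNC {D : ℕ → ℕ → Prop} {N : ℕ} {f : ℕ → ℕ} (h : IsPairing D 0 N f)
    (x y : Fin N) :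
    Linked (kr (pairingNC N f)) x y ↔ SameRegion f (2 * x + 2) (2 * y + 2) := by
  simp only [linked_kr, linked_pairingNC]
  constructor
  · intro hs z
    rcases Nat.lt_or_ge z (2 * N) with hz | hz
    · have h1 := h.sameRegion_partner hz
      have h2 := h.lt hz
      have h3 := h.odd z (by omega) (by omega)
      have h4 := h.sameRegion_partner h2
      rw [h.invol] at h4
      -- The odd gaps next to the ends of the arc at `z` belong to linked points, and this linked
      -- pair separates even gaps just as the arc does.
      have h5 := hs ⟨z / 2, by omega⟩ ⟨f z / 2, by omega⟩ (by
        rcases Nat.mod_two_eq_zero_or_one z with hz2 | hz2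
        · convert h4.symm using 1 <;> simp only <;> omega
        · convert h1 using 1 <;> simp only <;> omega)
      simp only [Fin.lt_def] at h5
      omega
    · rw [h.fix z (by omega)]
      tauto
  · intro hxy a b hab
    by_contra hc
    -- A linked pair separating the two even gaps would put an even and an odd gap in one region.
    have h1 := hxy.of_crossing hab (by omega)
    rcases Nat.le_total (2 * x + 2 : ℕ) (2 * a + 1) with hle | hle
    · have := h.sameRegion_parity hle (by omega) h1
      omega
    · have := h.sameRegion_parity hle (by omega) h1.symm
      omega

/-! ### From non-crossing partitions to pairings -/

/-- A non-crossing equivalence relation on `[0, N)`. -/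
structure IsNCRel (N : ℕ) (r : ℕ → ℕ → Prop) : Prop where
  refl : ∀ i, i < N → r i i
  symm : ∀ i j, r i j → r j i
  trans : ∀ i j k, r i j → r j k → r i k
  lt : ∀ i j, r i j → i < N ∧ j < N
  nc : ∀ a b c d, a < b → b < c → c < d → r a c → r b d → r a b

/-- In the cyclic order, `j` is the element after `i` in the class of `i`. -/
def IsNext (r : ℕ → ℕ → Prop) (i j : ℕ) : Prop :=
  r i j ∧ ((i < j ∧ ∀ k, r i k → k ≤ i ∨ j ≤ k) ∨ (j ≤ i ∧ ∀ k, r i k → j ≤ k ∧ k ≤ i))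

namespace IsNCRel

variable {N : ℕ} {r : ℕ → ℕ → Prop}

theorem exists_next (h : IsNCRel N r) {i : ℕ} (hi : i < N) : ∃ j, IsNext r i j := by
  classical
  by_cases hex : ∃ j, i < j ∧ r i j
  · refine ⟨Nat.find hex, (Nat.find_spec hex).2, Or.inl ⟨(Nat.find_spec hex).1, fun k hk => ?_⟩⟩
    by_contra! hc
    exact Nat.find_min hex hc.2 ⟨hc.1, hk⟩
  · have hex' : ∃ j, r i j := ⟨i, h.refl i hi⟩
    push Not at hex
    exact ⟨Nat.find hex', Nat.find_spec hex', Or.inr ⟨Nat.find_min' hex' (h.refl i hi),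
      fun k hk => ⟨Nat.find_min' hex' hk, not_lt.1 fun hlt => hex k hlt hk⟩⟩⟩

theorem exists_greatest (h : IsNCRel N r) {j : ℕ} (P : ℕ → Prop) (hP : ∃ i, r i j ∧ P i) :
    ∃ i, r i j ∧ P i ∧ ∀ k, r k j → P k → k ≤ i := by
  classical
  obtain ⟨i, hi, hPi⟩ := hP
  have hs := Nat.findGreatest_spec (P := fun i => r i j ∧ P i) (h.lt i j hi).1.le ⟨hi, hPi⟩
  exact ⟨_, hs.1, hs.2, fun k hk hPk => Nat.le_findGreatest (h.lt k j hk).1.le ⟨hk, hPk⟩⟩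

theorem exists_prev (h : IsNCRel N r) {j : ℕ} (hj : j < N) : ∃ i, IsNext r i j := by
  by_cases hex : ∃ i, r i j ∧ i < j
  · obtain ⟨i, hi, hij, hmax⟩ := h.exists_greatest _ hex
    refine ⟨i, hi, Or.inl ⟨hij, fun k hk => ?_⟩⟩
    have := hmax k (h.trans _ _ _ (h.symm _ _ hk) hi)
    omega
  · obtain ⟨i, hi, -, hmax⟩ := h.exists_greatest (j := j) (fun _ => True) ⟨j, h.refl j hj, trivial⟩
    push Not at hex
    refine ⟨i, hi, Or.inr ⟨hmax j (h.refl j hj) trivial, fun k hk => ?_⟩⟩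
    have h1 := h.trans _ _ _ (h.symm _ _ hk) hi
    exact ⟨hex k h1, hmax k h1 trivial⟩

theorem next_unique (h : IsNCRel N r) {i j j' : ℕ} (h1 : IsNext r i j) (h2 : IsNext r i j') :
    j = j' := by
  have h3 := h.refl i (h.lt _ _ h1.1).1
  obtain ⟨h1, h1'⟩ := h1
  obtain ⟨h2, h2'⟩ := h2
  have a2 := fun h => h1'.imp_right (fun t => t.2 j' h)
  grind

theorem prev_unique (h : IsNCRel N r) {i i' j : ℕ} (h1 : IsNext r i j) (h2 : IsNext r i' j) :
    i = i' := by
  have h3 := h.trans _ _ _ h1.1 (h.symm _ _ h2.1)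
  have h4 := h.symm _ _ h3
  have h5 := h.refl j (h.lt _ _ h1.1).2
  obtain ⟨h1, h1'⟩ := h1
  obtain ⟨h2, h2'⟩ := h2
  grind

/-- The arc from `2 * a + 1` to `2 * b` does not separate the gaps `2 * i + 1` and `2 * j + 1`: `a <
i` and `b ≤ i` say that its ends lie before the gap of `i`. -/
theorem next_side (h : IsNCRel N r) {a b i j : ℕ} (hab : IsNext r a b) (hij : r i j) :
    (a < i ↔ b ≤ i) ↔ (a < j ↔ b ≤ j) := by
  obtain ⟨h1, h1'⟩ := hab
  have h2 := h.symm _ _ h1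
  have h3 := h.symm _ _ hij
  by_cases hai : r a i
  · have h4 := h.trans _ _ _ hai hij
    rcases h1' with ⟨hlt, hm⟩ | ⟨hle, hm⟩ <;>
    · have := hm i hai
      have := hm j h4
      omega
  · have haj : ¬ r a j := fun h4 => hai (h.trans _ _ _ h4 h3)
    have hbi : ¬ r b i := fun h4 => hai (h.trans _ _ _ h1 h4)
    have hbj : ¬ r b j := fun h4 => haj (h.trans _ _ _ h1 h4)
    have n1 : a ≠ i := by rintro rfl; exact hai (h.refl _ (h.lt _ _ h1).1)
    have n2 : a ≠ j := by rintro rfl; exact haj (h.refl _ (h.lt _ _ h1).1)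
    have n3 : b ≠ i := by rintro rfl; exact hbi (h.refl _ (h.lt _ _ h1).2)
    have n4 : b ≠ j := by rintro rfl; exact hbj (h.refl _ (h.lt _ _ h1).2)
    have c1 : ¬ (a < i ∧ i < b ∧ b < j) := fun ⟨p, q, t⟩ => hai (h.nc a i b j p q t h1 hij)
    have c2 : ¬ (a < j ∧ j < b ∧ b < i) := fun ⟨p, q, t⟩ => haj (h.nc a j b i p q t h1 h3)
    have c3 : ¬ (b < i ∧ i < a ∧ a < j) := fun ⟨p, q, t⟩ => hbi (h.nc b i a j p q t h2 hij)
    have c4 : ¬ (b < j ∧ j < a ∧ a < i) := fun ⟨p, q, t⟩ => hbj (h.nc b j a i p q t h2 h3)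
    have c5 : ¬ (i < a ∧ a < j ∧ j < b) := fun ⟨p, q, t⟩ => hai (h.symm _ _ (h.nc i a j b p q t hij h1))
    have c6 : ¬ (j < a ∧ a < i ∧ i < b) := fun ⟨p, q, t⟩ => haj (h.symm _ _ (h.nc j a i b p q t h3 h1))
    have c7 : ¬ (i < b ∧ b < j ∧ j < a) := fun ⟨p, q, t⟩ => hbi (h.symm _ _ (h.nc i b j a p q t hij h2))
    have c8 : ¬ (j < b ∧ b < i ∧ i < a) := fun ⟨p, q, t⟩ => hbj (h.symm _ _ (h.nc j b i a p q t h3 h2))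
    omega

end IsNCRel

namespace IsNCRel

variable {N : ℕ} {r : ℕ → ℕ → Prop}

/-- The pairing of `[0, 2 * N)` that matches `2 * i + 1` with twice the element after `i`. -/
theorem exists_pairing (h : IsNCRel N r) : ∃ f : ℕ → ℕ, IsPairing (fun _ _ => True) 0 N f ∧
    ∀ i j, i < N → j < N → (SameRegion f (2 * i + 1) (2 * j + 1) ↔ r i j) := by
  classical
  choose! σ hσ using fun i (hi : i < N) => h.exists_next hi
  choose! τ hτ using fun j (hj : j < N) => h.exists_prev hj
  have hσN : ∀ i, i < N → σ i < N := fun i hi => (h.lt _ _ (hσ i hi).1).2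
  have hτN : ∀ i, i < N → τ i < N := fun i hi => (h.lt _ _ (hτ i hi).1).1
  have hτσ : ∀ i, i < N → τ (σ i) = i := fun i hi =>
    h.prev_unique (hτ _ (hσN i hi)) (hσ i hi)
  have hστ : ∀ i, i < N → σ (τ i) = i := fun i hi =>
    h.next_unique (hσ _ (hτN i hi)) (hτ i hi)
  obtain ⟨f, hf⟩ : ∃ f : ℕ → ℕ, f = fun x =>
    if x < 2 * N then if x % 2 = 1 then 2 * σ (x / 2) else 2 * τ (x / 2) + 1 else x := ⟨_, rfl⟩
  have hf1 : ∀ i, i < N → f (2 * i + 1) = 2 * σ i := by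
    intro i hi
    rw [hf]
    simp only
    rw [if_pos (by omega), if_pos (by omega), show (2 * i + 1) / 2 = i by omega]
  have hf0 : ∀ i, i < N → f (2 * i) = 2 * τ i + 1 := by
    intro i hi
    rw [hf]
    simp only
    rw [if_pos (by omega), if_neg (by omega), show 2 * i / 2 = i by omega]
  have hfN : ∀ x, 2 * N ≤ x → f x = x := by
    intro x hx
    rw [hf]
    simp only
    rw [if_neg (by omega)]
  have hcases : ∀ x, (∃ i < N, x = 2 * i) ∨ (∃ i < N, x = 2 * i + 1) ∨ 2 * N ≤ x := by
    intro x
    by_cases hx : x < 2 * N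
    · rcases Nat.mod_two_eq_zero_or_one x with h2 | h2
      · exact Or.inl ⟨x / 2, by omega, by omega⟩
      · exact Or.inr (Or.inl ⟨x / 2, by omega, by omega⟩)
    · exact Or.inr (Or.inr (by omega))
  have side : ∀ i j, i < N → r i j →
      (∀ a, a < N → ((a < i ↔ σ a ≤ i) ↔ (a < j ↔ σ a ≤ j))) :=
    fun i j _ hij a ha => h.next_side (hσ a ha) hij
  have hregion : ∀ i j, i < N → r i j → SameRegion f (2 * i + 1) (2 * j + 1) := by
    intro i j hi hij x
    rcases hcases x with ⟨a, ha, rfl⟩ | ⟨a, ha, rfl⟩ | hx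
    · rw [hf0 a ha]
      have := side i j hi hij (τ a) (hτN a ha)
      rw [hστ a ha] at this
      omega
    · rw [hf1 a ha]
      have := side i j hi hij a ha
      omega
    · rw [hfN x hx]
      tauto
  refine ⟨f, ⟨?_, ?_, fun _ _ _ => trivial, ?_, ?_⟩, fun i j hi hj => ⟨fun hs => ?_, hregion i j hi⟩⟩
  · intro x
    rcases hcases x with ⟨a, ha, rfl⟩ | ⟨a, ha, rfl⟩ | hx
    · rw [hf0 a ha, hf1 _ (hτN a ha), hστ a ha]
    · rw [hf1 a ha, hf0 _ (hσN a ha), hτσ a ha]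
    · rw [hfN x hx, hfN x hx]
  · intro x hx
    exact hfN x (by omega)
  · intro x _ _
    rcases hcases x with ⟨a, ha, rfl⟩ | ⟨a, ha, rfl⟩ | hx
    · rw [hf0 a ha]
      omega
    · rw [hf1 a ha]
      omega
    · omega
  · have key : ∀ i a, i < N → a < N → ((i < a ↔ σ i ≤ a) ↔ (i < σ a ↔ σ i ≤ σ a)) :=
      fun i a hi ha => h.next_side (hσ i hi) (hσ a ha).1
    have hinj : ∀ i a, i < N → a < N → σ i = σ a → i = a := fun i a hi ha hia => by
      rw [← hτσ i hi, hia, hτσ a ha]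
    have hrep : ∀ x, x < 2 * N → ∃ i < N, (x = 2 * i + 1 ∧ f x = 2 * σ i) ∨
        (x = 2 * σ i ∧ f x = 2 * i + 1) := by
      intro x hx
      rcases hcases x with ⟨a, ha, rfl⟩ | ⟨a, ha, rfl⟩ | hx
      · exact ⟨τ a, hτN a ha, Or.inr ⟨by rw [hστ a ha], hf0 a ha⟩⟩
      · exact ⟨a, ha, Or.inl ⟨rfl, hf1 a ha⟩⟩
      · omega
    intro x y hxy hyx
    have hx : x < 2 * N := by
      by_contra hx
      rw [hfN x (by omega)] at hyx
      omega
    obtain ⟨i, hi, hxi⟩ := hrep x hx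
    have hσi := hσN i hi
    obtain ⟨a, ha, hya⟩ := hrep y (by omega)
    have h1 := key i a hi ha
    have h2 := hinj i a hi ha
    have h3 : i = a → σ i = σ a := congrArg σ
    omega
  · have main : ∀ i j, i < j → j < N → SameRegion f (2 * i + 1) (2 * j + 1) → r i j := by
      intro i j hij hj hs
      by_contra hn
      -- The arc leaving the last element before `j` in the class of `i` either jumps over `j` or
      -- returns to the first element of the class; in both cases it separates `i` from `j`.
      obtain ⟨a, ha, haj, hmax⟩ := h.exists_greatest (j := i) (fun a => a < j)
        ⟨i, h.refl i (by omega), hij⟩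
      have haN : a < N := (h.lt _ _ ha).1
      have hia := hmax i (h.refl i (by omega)) hij
      obtain ⟨hr, hn1⟩ := hσ a haN
      have h1 := hs (2 * a + 1)
      rw [hf1 a haN] at h1
      have hσi := h.trans _ _ _ (h.symm _ _ hr) ha
      have h2 := hmax _ hσi
      have h3 : σ a ≠ j := by
        intro h3
        rw [h3] at hσi
        exact hn (h.symm _ _ hσi)
      rcases hn1 with ⟨h4, -⟩ | ⟨h4, h5⟩
      · omega
      · have := h5 i ha
        omega
    rcases lt_trichotomy i j with hij | rfl | hij
    · exact main i j hij hj hs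
    · exact h.refl i hi
    · exact h.symm _ _ (main j i hij hi hs.symm)

end IsNCRel

theorem exists_pairingNC_eq {N : ℕ} (p : NCA N) :
    ∃ f, IsPairing (fun _ _ => True) 0 N f ∧ pairingNC N f = p := by
  have h : IsNCRel N (fun i j => ∃ (hi : i < N) (hj : j < N), Linked p.1 ⟨i, hi⟩ ⟨j, hj⟩) := {
    refl := fun i hi => ⟨hi, hi, linked_refl _ _⟩
    symm := fun i j ⟨hi, hj, h⟩ => ⟨hj, hi, linked_symm h⟩
    trans := fun i j k ⟨hi, _, h⟩ ⟨_, hk, h'⟩ => ⟨hi, hk, linked_trans h h'⟩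
    lt := fun i j ⟨hi, hj, _⟩ => ⟨hi, hj⟩
    nc := fun a b c d hab hbc hcd ⟨ha, _, h⟩ ⟨hb, _, h'⟩ => ⟨ha, hb, p.2 hab hbc hcd h h'⟩ }
  obtain ⟨f, hf, hfr⟩ := h.exists_pairing
  refine ⟨f, hf, Subtype.ext (finpartition_ext_linked fun x y => ?_)⟩
  rw [linked_pairingNC, hfr x y x.2 y.2]
  simp

/-! ### Pairings lying over `ρ` -/

namespace IsPairing

variable {C D : ℕ → ℕ → Prop} {n N : ℕ} {f ρ : ℕ → ℕ}

/-- The gaps beside `x` and those beside `y` lie in the same two regions of `ρ`. Two regions share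
at most one arc, so `x` and `y` lie over ends of the same arc, and by parity over different ends. -/
theorem periodic_of_periodicRegion (hn : 0 < n) (h : IsPairing D 0 n ρ) {x y : ℕ} (hxy : x < y)
    (hodd : (x + y) % 2 = 1) (h1 : PeriodicRegion n ρ x (y + 1))
    (h2 : PeriodicRegion n ρ (x + 1) y) : Periodic n ρ x y := by
  obtain ⟨e, he, hen, hstep, hmin⟩ := h.exists_step hn x
  have h3 := hmin (y + 1 - x) (by omega) (by rwa [show x + (y + 1 - x) = y + 1 by omega])
  obtain ⟨d, hd⟩ : ∃ d, y + 1 = x + 2 * e + 2 * d := ⟨(y + 1 - x - 2 * e) / 2, by omega⟩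
  have hdm := Nat.div_add_mod d n
  have hr := Nat.mod_lt d hn
  set s := d / n
  set r := d % n
  rcases Nat.eq_zero_or_pos r with h0 | h0
  · rw [show y = x + 2 * (e - 1 + d) + 1 by omega, hstep]
    exact ⟨s, by omega⟩
  -- The first partner `z` of `x`; mod `2 * n`, the endpoint `y` is `z + 2 * r`.
  have hz : Periodic n ρ x (x + 2 * (e - 1) + 1) := (hstep _).2 ⟨0, by omega⟩
  have hz1 := h.periodicRegion_right hn hz
  have hz2 := h.periodicRegion_left hn hz
  have hy1 : PeriodicRegion n ρ y (x + 2 * (e - 1) + 1 + 2 * r) := PeriodicRegion.of_mod_eq (by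
    rw [show y = x + 2 * (e - 1) + 1 + 2 * r + 2 * n * s by rw [mul_assoc]; omega]
    simp)
  have hy2 : PeriodicRegion n ρ (y + 1) (x + 2 * (e - 1) + 1 + 2 * r + 1) :=
    PeriodicRegion.of_mod_eq (by
    rw [show y + 1 = x + 2 * (e - 1) + 1 + 2 * r + 1 + 2 * n * s by rw [mul_assoc]; omega]
    simp)
  have h4 := hz2.symm.trans (h2.trans hy1)
  have h5 := h1.trans hy2
  obtain ⟨e', he', hen', hstep', hmin'⟩ := h.exists_step hn (x + 2 * (e - 1) + 1)
  have h6 := hmin' (2 * r) (by omega) h4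
  -- The next partner of `z` is `x + 2 * n`. Hence `r ≥ n + 1 - e`, and the region of gap `x` recurs
  -- after `2 * e + 2 * r - 2 * n`, which is positive but less than `2 * e`.
  have h7 : e' = n + 1 - e := by
    have h8 : Periodic n ρ (x + 2 * (e - 1) + 1) (x + 2 * (e - 1) + 1 + 2 * (n - e) + 1) := by
      have := h.periodic_symm hz
      unfold Periodic at *
      rw [← this, show x + 2 * (e - 1) + 1 + 2 * (n - e) + 1 = x + 2 * n by omega]
      simp
    obtain ⟨s', hs'⟩ := (hstep' _).1 h8
    rcases Nat.eq_zero_or_pos s' with rfl | hs0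
    · omega
    · have := Nat.le_mul_of_pos_right n hs0
      omega
  have h8 := hmin (2 * e + 2 * r - 2 * n) (by omega) (h5.trans (PeriodicRegion.of_mod_eq (by
    rw [show x + 2 * (e - 1) + 1 + 2 * r + 1 = x + (2 * e + 2 * r - 2 * n) + 2 * n by omega]
    simp)))
  omega

/-- A pairing of `[0, 2 * N)` whose regions lie over those of `ρ` respects the colours of `ρ`. -/
theorem periodic_of_le (hn : 0 < n) (hρ : IsPairing D 0 n ρ) (hf : IsPairing C 0 N f)
    (h : ∀ u v, u ≤ 2 * N → v ≤ 2 * N → SameRegion f u v → PeriodicRegion n ρ u v) :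
    IsPairing (Periodic n ρ) 0 N f := by
  have key : ∀ x, x < 2 * N → x < f x → Periodic n ρ x (f x) := by
    intro x hx hlt
    have h1 := hf.lt hx
    have h2 := hf.odd x (by omega) (by omega)
    have h3 := hf.sameRegion_partner h1
    rw [hf.invol] at h3
    exact hρ.periodic_of_periodicRegion hn hlt (by omega)
      (h _ _ (by omega) (by omega) (hf.sameRegion_partner hx))
      (h _ _ (by omega) (by omega) h3.symm)
  refine ⟨hf.invol, hf.fix, fun x _ hx => ?_, hf.odd, hf.nc⟩
  have h1 := hf.odd x (by omega) hx
  have h2 := hf.lt (x := x) (by omega)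
  rcases Nat.lt_or_ge x (f x) with hlt | hge
  · exact key x (by omega) hlt
  · have := key (f x) h2 (by rw [hf.invol]; omega)
    rw [hf.invol] at this
    exact hρ.periodic_symm this

/-- The step from `u` to `f u + 1` stays in a region of `f` and, by the colour condition, over a
region of `ρ`; such steps reach every later gap of the region. -/
theorem periodicRegion_of_sameRegion (hn : 0 < n) (hρ : IsPairing D 0 n ρ)
    (hf : IsPairing (Periodic n ρ) 0 N f) {u v : ℕ} (hu : u ≤ 2 * N) (hv : v ≤ 2 * N)
    (h : SameRegion f u v) : PeriodicRegion n ρ u v := by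
  have key : ∀ d u, u + d ≤ 2 * N → SameRegion f u (u + d) → PeriodicRegion n ρ u (u + d) := by
    intro d
    induction d using Nat.strong_induction_on with
    | _ d ih =>
      intro u hd hr
      rcases Nat.eq_zero_or_pos d with rfl | h0
      · exact PeriodicRegion.refl _ _ _
      · have h1 := hf.partner_mem (by omega) hd hr
        have h2 := ih (u + d - (f u + 1)) (by omega) (f u + 1) (by omega)
        rw [show f u + 1 + (u + d - (f u + 1)) = u + d by omega] at h2
        exact (hρ.periodicRegion_right hn (hf.color u (by omega) (by omega))).trans
          (h2 ((hf.sameRegion_partner (by omega)).symm.trans hr))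
  rcases Nat.le_total u v with huv | huv
  · have := key (v - u) u
    rw [show u + (v - u) = v by omega] at this
    exact this hv h
  · have := key (u - v) v
    rw [show v + (u - v) = u by omega] at this
    exact (this hu h.symm).symm

/-- It suffices to know the partition defined by `f` and its complement to find the regions. -/
theorem sameRegion_imp (hf : IsPairing C 0 N f) {T : ℕ → ℕ → Prop}
    (hsymm : ∀ u v, T u v → T v u)
    (htrans : ∀ u v w, T u v → T v w → T u w) (h0 : T 0 (2 * N))
    (h1 : ∀ i j : Fin N, Linked (pairingNC N f).1 i j → T (2 * i + 1) (2 * j + 1))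
    (h2 : ∀ i j : Fin N, Linked (kr (pairingNC N f)) i j → T (2 * i + 2) (2 * j + 2))
    {u v : ℕ} (hu : u ≤ 2 * N) (hv : v ≤ 2 * N) (h : SameRegion f u v) : T u v := by
  have key : ∀ u v, 0 < u → u ≤ v → v ≤ 2 * N → SameRegion f u v → T u v := by
    intro u v hu huv hv h
    have hp := hf.sameRegion_parity huv hv h
    rcases Nat.mod_two_eq_zero_or_one u with hu2 | hu2
    · obtain ⟨i, rfl⟩ : ∃ i, u = 2 * i + 2 := ⟨u / 2 - 1, by omega⟩
      obtain ⟨j, rfl⟩ : ∃ j, v = 2 * j + 2 := ⟨v / 2 - 1, by omega⟩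
      exact h2 ⟨i, by omega⟩ ⟨j, by omega⟩ ((linked_kr_pairingNC hf _ _).2 h)
    · obtain ⟨i, rfl⟩ : ∃ i, u = 2 * i + 1 := ⟨u / 2, by omega⟩
      obtain ⟨j, rfl⟩ : ∃ j, v = 2 * j + 1 := ⟨v / 2, by omega⟩
      exact h1 ⟨i, by omega⟩ ⟨j, by omega⟩ ((linked_pairingNC _ _).2 h)
  -- Gap 0 belongs to no point, plain or barred, and is replaced by gap `2 * N`.
  have key' : ∀ u v, u ≤ v → v ≤ 2 * N → SameRegion f u v → T u v := by
    intro u v huv hv h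
    rcases Nat.eq_zero_or_pos u with rfl | hu
    · rcases Nat.eq_zero_or_pos v with rfl | hv0
      · exact htrans _ _ _ h0 (hsymm _ _ h0)
      · exact htrans _ _ _ h0 (hsymm _ _ (key v _ hv0 hv le_rfl (h.symm.trans hf.sameRegion_zero)))
    · exact key u v hu huv hv h
  rcases Nat.le_total u v with huv | huv
  · exact key' u v huv hv h
  · exact hsymm _ _ (key' v u huv hu h.symm)

end IsPairing

theorem pairingNC_injective {C D : ℕ → ℕ → Prop} {N : ℕ} {f g : ℕ → ℕ} (hN : 0 < N)
    (hf : IsPairing C 0 N f) (hg : IsPairing D 0 N g) (h : pairingNC N f = pairingNC N g) :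
    f = g := by
  -- With a single period, respecting the colours of `g` means being equal to `g`.
  have h1 : IsPairing (Periodic N g) 0 N f := hg.periodic_of_le hN hf fun u v hu hv huv => by
    rw [hg.periodicRegion_iff hu hv rfl rfl]
    refine hf.sameRegion_imp (T := SameRegion g) (fun u v => SameRegion.symm) (fun u v w => SameRegion.trans)
      hg.sameRegion_zero (fun i j hij => ?_) (fun i j hij => ?_) hu hv huv
    · rwa [h, linked_pairingNC] at hij
    · rwa [h, linked_kr_pairingNC hg] at hij
  funext x
  rcases Nat.lt_or_ge x (2 * N) with hx | hx
  · have h2 := h1.color x (by omega) (by omega)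
    unfold Periodic at h2
    rwa [Nat.mod_eq_of_lt (hf.lt hx), Nat.mod_eq_of_lt hx] at h2
  · rw [hf.fix x (by omega), hg.fix x (by omega)]

/-! ### Reduction of blocks -/

theorem redPoint_val {n k : ℕ} (i : Fin ((k + 1) * n)) : (redPoint n k i : ℕ) = i % n := rfl

theorem redPoint_surjective (n k : ℕ) : Function.Surjective (redPoint n k) := fun a =>
  ⟨⟨a, a.2.trans_le (Nat.le_mul_of_pos_left n k.succ_pos)⟩, Fin.ext (Nat.mod_eq_of_lt a.2)⟩

/-- `Red π` is the partition `q` if and only if the blocks of `π` are mapped into blocks of `q`,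
and onto them. -/
theorem redBlocks_eq_parts_iff {n k : ℕ}
    {π : Finpartition (Finset.univ : Finset (Fin ((k + 1) * n)))}
    {q : Finpartition (Finset.univ : Finset (Fin n))} :
    redBlocks n k π = q.parts ↔
      (∀ i j, Linked π i j → Linked q (redPoint n k i) (redPoint n k j)) ∧
      ∀ i b, Linked q (redPoint n k i) b → ∃ j, Linked π i j ∧ redPoint n k j = b := by
  constructor
  · intro h
    have h1 : ∀ i, (π.part i).image (redPoint n k) = q.part (redPoint n k i) := by
      intro i
      have h2 : (π.part i).image (redPoint n k) ∈ q.parts := by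
        rw [← h]
        exact Finset.mem_image_of_mem _ (part_mem_parts π i)
      exact (q.part_eq_of_mem h2
        (Finset.mem_image_of_mem _ (π.mem_part (Finset.mem_univ i)))).symm
    simp only [linked_iff_mem_part, ← h1]
    refine ⟨fun i j hij => Finset.mem_image_of_mem _ hij, fun i b hb => ?_⟩
    simpa using hb
  · rintro ⟨h1, h2⟩
    have h3 : ∀ i, (π.part i).image (redPoint n k) = q.part (redPoint n k i) := by
      intro i
      ext b
      rw [Finset.mem_image, ← linked_iff_mem_part]
      constructor
      · rintro ⟨j, hj, rfl⟩
        exact h1 i j (linked_iff_mem_part.2 hj)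
      · intro hb
        obtain ⟨j, hj, hjb⟩ := h2 i b hb
        exact ⟨j, linked_iff_mem_part.1 hj, hjb⟩
    rw [redBlocks, parts_eq_image_part π, parts_eq_image_part q, Finset.image_image]
    ext V
    simp only [Finset.mem_image, Finset.mem_univ, true_and, Function.comp_apply, h3]
    exact ((redPoint_surjective n k).exists (p := fun a => q.part a = V)).symm

theorem plain_gap_mod (n i : ℕ) : (2 * i + 1) % (2 * n) = (2 * (i % n) + 1) % (2 * n) :=
  (((Nat.mod_modEq i n).symm.mul_left' 2).add_right 1 : _ ≡ _ [MOD 2 * n])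

theorem bar_gap_mod (n i : ℕ) : (2 * i + 2) % (2 * n) = (2 * (i % n) + 2) % (2 * n) :=
  (((Nat.mod_modEq i n).symm.mul_left' 2).add_right 2 : _ ≡ _ [MOD 2 * n])

theorem mod_eq_of_gap_mod {n i j c : ℕ} (h : (2 * i + c) % (2 * n) = (2 * j + c) % (2 * n)) :
    i % n = j % n :=
  Nat.ModEq.mul_left_cancel' two_ne_zero (Nat.ModEq.add_right_cancel' c h)

theorem isNonCrossing_kr {n : ℕ} (p : NCA n) : IsNonCrossing (kr p) := by
  obtain ⟨ρ, hρ, rfl⟩ := exists_pairingNC_eq p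
  intro a b c d hab hbc hcd hac hbd
  rw [linked_kr_pairingNC hρ] at *
  exact SameRegion.of_crossing hac hbd (by omega)

namespace IsPairing

variable {D : ℕ → ℕ → Prop} {n k : ℕ} {f ρ : ℕ → ℕ}

theorem periodicRegion_plain (hρ : IsPairing D 0 n ρ) (i j : Fin ((k + 1) * n)) :
    PeriodicRegion n ρ (2 * i + 1) (2 * j + 1) ↔
      Linked (pairingNC n ρ).1 (redPoint n k i) (redPoint n k j) := by
  have hi := (redPoint n k i).2
  have hj := (redPoint n k j).2
  rw [linked_pairingNC]
  exact hρ.periodicRegion_iff (by omega) (by omega) (plain_gap_mod n i) (plain_gap_mod n j)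

theorem periodicRegion_bar (hρ : IsPairing D 0 n ρ) (i j : Fin ((k + 1) * n)) :
    PeriodicRegion n ρ (2 * i + 2) (2 * j + 2) ↔
      Linked (kr (pairingNC n ρ)) (redPoint n k i) (redPoint n k j) := by
  have hi := (redPoint n k i).2
  have hj := (redPoint n k j).2
  rw [linked_kr_pairingNC hρ]
  exact hρ.periodicRegion_iff (by omega) (by omega) (bar_gap_mod n i) (bar_gap_mod n j)

/-- The regions of a pairing that respects the colours of `ρ` are mapped onto the regions of `ρ`. -/
theorem exists_sameRegion_lift (hn : 0 < n) (hρ : IsPairing D 0 n ρ)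
    (hf : IsPairing (Periodic n ρ) 0 ((k + 1) * n) f) {u v : ℕ} (hu : u ≤ 2 * ((k + 1) * n))
    (huv : PeriodicRegion n ρ u v) :
    ∃ w < 2 * ((k + 1) * n), SameRegion f u w ∧ w % (2 * n) = v % (2 * n) := by
  have hN : 0 < (k + 1) * n := by positivity
  have hmod : 2 * ((k + 1) * n) % (2 * n) = 0 := by
    rw [show 2 * ((k + 1) * n) = 2 * n * (k + 1) by ring]
    simp
  -- Walk along the region of `f`. Each step has the residue of the step to the first partner in the
  -- periodic picture, which shortens the remaining distance `d` by `2 * e`.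
  have key : ∀ d w, w < 2 * ((k + 1) * n) → SameRegion f u w → PeriodicRegion n ρ w (w + d) →
      ∃ w' < 2 * ((k + 1) * n), SameRegion f u w' ∧ w' % (2 * n) = (w + d) % (2 * n) := by
    intro d
    induction d using Nat.strong_induction_on with
    | _ d ih =>
      intro w hw hr hd
      rcases Nat.eq_zero_or_pos d with rfl | h0
      · exact ⟨w, hw, hr, rfl⟩
      obtain ⟨e, he, hen, hstep, hmin⟩ := hρ.exists_step hn w
      have hed := hmin d h0 hd
      have h1 : Periodic n ρ w (w + 2 * (e - 1) + 1) := (hstep _).2 ⟨0, by omega⟩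
      have h2 := hf.color w (by omega) (by omega)
      have h3 : (f w + 1 + (d - 2 * e)) % (2 * n) = (w + d) % (2 * n) := by
        unfold Periodic at h1 h2
        rw [show w + d = w + 2 * (e - 1) + 1 + (1 + (d - 2 * e)) by omega, add_assoc (f w),
          Nat.add_mod, h2, ← h1, ← Nat.add_mod]
      have h4 : PeriodicRegion n ρ (f w + 1) (f w + 1 + (d - 2 * e)) :=
        ((hρ.periodicRegion_right hn h2).symm.trans hd).trans (PeriodicRegion.of_mod_eq h3.symm)
      have h5 := hr.trans (hf.sameRegion_partner hw)
      have h6 := hf.lt hw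
      rcases Nat.lt_or_ge (f w + 1) (2 * ((k + 1) * n)) with hlt | hge
      · rw [← h3]
        exact ih _ (by omega) _ hlt h5 h4
      -- The walk has reached the last gap and continues from gap 0, which has the same region and
      -- residue.
      · have h7 : f w + 1 = 2 * ((k + 1) * n) := by omega
        rw [h7] at h3 h4 h5
        have h8 : (0 + (d - 2 * e)) % (2 * n) =
            (2 * ((k + 1) * n) + (d - 2 * e)) % (2 * n) := by
          rw [Nat.add_mod (2 * ((k + 1) * n)), hmod]
          simp
        rw [← h3, ← h8]
        refine ih _ (by omega) 0 (by omega) (h5.trans hf.sameRegion_zero.symm) ?_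
        exact ((PeriodicRegion.of_mod_eq (by rw [hmod]; simp)).trans h4).trans
          (PeriodicRegion.of_mod_eq h8.symm)
  have key' : ∀ w, w < 2 * ((k + 1) * n) → SameRegion f u w → PeriodicRegion n ρ w v →
      ∃ w' < 2 * ((k + 1) * n), SameRegion f u w' ∧ w' % (2 * n) = v % (2 * n) := by
    intro w hw hr hv
    -- A multiple of the period moves the target to the right of `w`.
    have h1 : w ≤ v + 2 * n * w := by nlinarith
    have h2 := key (v + 2 * n * w - w) w hw hr
    rw [show w + (v + 2 * n * w - w) = v + 2 * n * w by omega] at h2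
    have h3 : v % (2 * n) = (v + 2 * n * w) % (2 * n) := by simp
    rw [h3]
    exact h2 (hv.trans (PeriodicRegion.of_mod_eq h3))
  rcases hu.lt_or_eq with hlt | rfl
  · exact key' u hlt (SameRegion.refl _ _) huv
  · exact key' 0 (by omega) hf.sameRegion_zero.symm
      ((PeriodicRegion.of_mod_eq (by rw [hmod]; simp)).trans huv)

theorem redBlocks_pairingNC (hn : 0 < n) (hρ : IsPairing D 0 n ρ)
    (hf : IsPairing (Periodic n ρ) 0 ((k + 1) * n) f) :
    redBlocks n k (pairingNC ((k + 1) * n) f).1 = (pairingNC n ρ).1.parts := by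
  rw [redBlocks_eq_parts_iff]
  constructor
  · intro i j hij
    rw [linked_pairingNC] at hij
    rw [← hρ.periodicRegion_plain]
    exact hρ.periodicRegion_of_sameRegion hn hf (by omega) (by omega) hij
  · intro i b hb
    obtain ⟨b, rfl⟩ := redPoint_surjective n k b
    rw [← hρ.periodicRegion_plain] at hb
    obtain ⟨w, hw, hr, hwb⟩ := hρ.exists_sameRegion_lift hn hf (by omega) hb
    have hp : w % 2 = 1 := by
      have := congrArg (· % 2) hwb
      simp only [Nat.mod_mul_right_mod] at this
      omega
    obtain ⟨j, rfl⟩ : ∃ j, w = 2 * j + 1 := ⟨w / 2, by omega⟩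
    exact ⟨⟨j, by omega⟩, (linked_pairingNC _ _).2 hr, Fin.ext (mod_eq_of_gap_mod hwb)⟩

theorem redBlocks_kr_pairingNC (hn : 0 < n) (hρ : IsPairing D 0 n ρ)
    (hf : IsPairing (Periodic n ρ) 0 ((k + 1) * n) f) :
    redBlocks n k (kr (pairingNC ((k + 1) * n) f)) = (kr (pairingNC n ρ)).parts := by
  have hN : 0 < (k + 1) * n := by positivity
  rw [redBlocks_eq_parts_iff]
  constructor
  · intro i j hij
    rw [linked_kr_pairingNC hf] at hij
    rw [← hρ.periodicRegion_bar]
    exact hρ.periodicRegion_of_sameRegion hn hf (by omega) (by omega) hij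
  · intro i b hb
    obtain ⟨b, rfl⟩ := redPoint_surjective n k b
    rw [← hρ.periodicRegion_bar] at hb
    obtain ⟨w, hw, hr, hwb⟩ := hρ.exists_sameRegion_lift hn hf (by omega) hb
    have hp : w % 2 = 0 := by
      have := congrArg (· % 2) hwb
      simp only [Nat.mod_mul_right_mod] at this
      omega
    -- Gap 0 is traded for the last gap, which is that of the last barred point.
    obtain ⟨j, hj, hjw, hjb⟩ : ∃ j < (k + 1) * n, SameRegion f w (2 * j + 2) ∧
        (2 * j + 2) % (2 * n) = w % (2 * n) := by
      rcases Nat.eq_zero_or_pos w with rfl | hw0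
      · refine ⟨(k + 1) * n - 1, by omega, ?_, ?_⟩
        · rw [show 2 * ((k + 1) * n - 1) + 2 = 2 * ((k + 1) * n) by omega]
          exact hf.sameRegion_zero
        · rw [show 2 * ((k + 1) * n - 1) + 2 = 2 * ((k + 1) * n) by omega,
            show 2 * ((k + 1) * n) = 2 * n * (k + 1) by ring]
          simp
      · refine ⟨w / 2 - 1, by omega, ?_⟩
        rw [show 2 * (w / 2 - 1) + 2 = w by omega]
        exact ⟨SameRegion.refl _ _, rfl⟩
    exact ⟨⟨j, hj⟩, (linked_kr_pairingNC hf _ _).2 (hr.trans hjw),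
      Fin.ext (mod_eq_of_gap_mod (hjb.trans hwb))⟩

end IsPairing

/-! ### Descent on crossing pairs -/

/-- Between a point congruent to `A` and a point congruent to `B` there is a point congruent to
`C` or `D`, if the pairs `A`, `B` and `C`, `D` cross. -/
theorem exists_between_of_crossing {n A B C D s t : ℕ} (hA : A ≤ 2 * n) (hB : 0 < B)
    (hB' : B ≤ 2 * n) (hC : 0 < C)
    (hC' : C ≤ 2 * n) (hD : 0 < D) (hD' : D ≤ 2 * n)
    (hAC : A ≠ C) (hAD : A ≠ D) (hBC : B ≠ C) (hBD : B ≠ D)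
    (hc : ¬ ((C < A ↔ C < B) ↔ (D < A ↔ D < B))) (hst : 2 * (n * s) + A < 2 * (n * t) + B) :
    ∃ r, (r = s ∨ r = t) ∧ ∃ E, (E = C ∨ E = D) ∧
      2 * (n * s) + A < 2 * (n * r) + E ∧ 2 * (n * r) + E < 2 * (n * t) + B := by
  rcases lt_trichotomy s t with hlt | rfl | hgt
  · have h1 := Nat.mul_le_mul_left n (show s + 1 ≤ t from hlt)
    rw [mul_add] at h1
    by_cases h2 : A < C
    · exact ⟨s, Or.inl rfl, C, Or.inl rfl, by omega, by omega⟩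
    by_cases h3 : A < D
    · exact ⟨s, Or.inl rfl, D, Or.inr rfl, by omega, by omega⟩
    by_cases h4 : C < B
    · exact ⟨t, Or.inr rfl, C, Or.inl rfl, by omega, by omega⟩
    · exact ⟨t, Or.inr rfl, D, Or.inr rfl, by omega, by omega⟩
  · by_cases h2 : A < C ∧ C < B
    · exact ⟨s, Or.inl rfl, C, Or.inl rfl, by omega, by omega⟩
    · exact ⟨s, Or.inl rfl, D, Or.inr rfl, by omega, by omega⟩
  · have h1 := Nat.mul_le_mul_left n (show t + 1 ≤ s from hgt)
    rw [mul_add] at h1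
    omega

/-- `A`, `B` and `C`, `D` are crossing pairs of gaps in `[0, 2 * n]`, of different parity, such that
the regions of `f` which contain a point congruent to one element of a pair also contain a point
congruent to the other. -/
structure CrossingCover (n k : ℕ) (f : ℕ → ℕ) (A B C D : ℕ) : Prop where
  posA : 0 < A
  posB : 0 < B
  posC : 0 < C
  posD : 0 < D
  leA : A ≤ 2 * n
  leB : B ≤ 2 * n
  leC : C ≤ 2 * n
  leD : D ≤ 2 * n
  parityAB : A % 2 = B % 2
  parityCD : C % 2 = D % 2
  parity : A % 2 ≠ C % 2
  crossing : ¬ ((C < A ↔ C < B) ↔ (D < A ↔ D < B))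
  coverAB : ∀ s ≤ k, ∃ t ≤ k, SameRegion f (2 * (n * s) + A) (2 * (n * t) + B)
  coverBA : ∀ s ≤ k, ∃ t ≤ k, SameRegion f (2 * (n * s) + B) (2 * (n * t) + A)
  coverCD : ∀ s ≤ k, ∃ t ≤ k, SameRegion f (2 * (n * s) + C) (2 * (n * t) + D)
  coverDC : ∀ s ≤ k, ∃ t ≤ k, SameRegion f (2 * (n * s) + D) (2 * (n * t) + C)

namespace CrossingCover

variable {E : ℕ → ℕ → Prop} {n k A B C D : ℕ} {f : ℕ → ℕ}

theorem swap (h : CrossingCover n k f A B C D) : CrossingCover n k f B A C D :=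
  ⟨h.posB, h.posA, h.posC, h.posD, h.leB, h.leA, h.leC, h.leD, h.parityAB.symm, h.parityCD,
    h.parityAB ▸ h.parity, by have := h.crossing; tauto,
    h.coverBA, h.coverAB, h.coverCD, h.coverDC⟩

theorem symm (h : CrossingCover n k f A B C D) : CrossingCover n k f C D A B :=
  ⟨h.posC, h.posD, h.posA, h.posB, h.leC, h.leD, h.leA, h.leB, h.parityCD, h.parityAB,
    h.parity.symm, by
      have h1 := h.crossing
      have h2 := h.parity
      have h3 := h.parityAB
      have h4 := h.parityCD
      omega,
    h.coverCD, h.coverDC, h.coverAB, h.coverBA⟩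

theorem gap_le (h : CrossingCover n k f A B C D) {s : ℕ} (hs : s ≤ k) :
    2 * (n * s) + A ≤ 2 * ((k + 1) * n) := by
  have := Nat.mul_le_mul_left n hs
  have : (k + 1) * n = n * k + n := by ring
  have := h.leA
  omega

theorem ne (h : CrossingCover n k f A B C D) (s t : ℕ) : 2 * (n * s) + A ≠ 2 * (n * t) + B := by
  intro hst
  have h1 := h.posA
  have h2 := h.posB
  have h3 := h.leA
  have h4 := h.leB
  have h5 : A ≠ B := by
    rintro rfl
    exact h.crossing (by tauto)
  rcases lt_trichotomy s t with hlt | rfl | hgt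
  · have := Nat.mul_le_mul_left n (show s + 1 ≤ t from hlt)
    rw [mul_add] at this
    omega
  · omega
  · have := Nat.mul_le_mul_left n (show t + 1 ≤ s from hgt)
    rw [mul_add] at this
    omega

/-- The pairs exchange roles, the one in the middle being ordered so that its first element has the
lift in between; the descent can then be iterated. -/
theorem exists_between (h : CrossingCover n k f A B C D) {s t : ℕ} (hs : s ≤ k) (ht : t ≤ k)
    (hst : 2 * (n * s) + A < 2 * (n * t) + B) :
    ∃ C' D', CrossingCover n k f C' D' A B ∧ ∃ r ≤ k,
      2 * (n * s) + A < 2 * (n * r) + C' ∧ 2 * (n * r) + C' < 2 * (n * t) + B := by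
  have h2 := h.parity
  have h3 := h.parityAB
  have h4 := h.parityCD
  obtain ⟨r, hr, F, hF, h5, h6⟩ := exists_between_of_crossing h.leA h.posB h.leB h.posC h.leC h.posD
    h.leD (by omega) (by omega) (by omega) (by omega) h.crossing hst
  have hrk : r ≤ k := by
    rcases hr with rfl | rfl <;> assumption
  rcases hF with rfl | rfl
  · exact ⟨_, _, h.symm, r, hrk, h5, h6⟩
  · exact ⟨_, _, h.symm.swap, r, hrk, h5, h6⟩

/-- Infinite descent on the distance. Between the two lifts lies a lift of `C` or `D`, whose region
contains a lift of the other one. That lift is also in between: otherwise the two regions would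
interlace and coincide, against parity. This gives a closer pair of the same kind. -/
theorem not_sameRegion (hf : IsPairing E 0 ((k + 1) * n) f) (d : ℕ) :
    ∀ {A B C D s t : ℕ}, CrossingCover n k f A B C D → s ≤ k → t ≤ k →
      2 * (n * s) + A + d = 2 * (n * t) + B →
      ¬ SameRegion f (2 * (n * s) + A) (2 * (n * t) + B) := by
  induction d using Nat.strong_induction_on with
  | _ d ih =>
    intro A B C D s t h hs ht hd hr
    obtain ⟨F, G, h', r, hrk, h1, h2⟩ := h.exists_between hs ht
      (lt_of_le_of_ne (by omega) (h.ne s t))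
    obtain ⟨u, hu, h3⟩ := h'.coverAB r hrk
    have hin : 2 * (n * s) + A < 2 * (n * u) + G ∧ 2 * (n * u) + G < 2 * (n * t) + B := by
      have h5 := h'.parity
      have h6 := h'.parityAB
      have h7 := h'.parityCD
      by_contra hout
      have h4 := hr.of_crossing h3 (by omega)
      have := hf.sameRegion_parity h1.le (h'.gap_le hrk) h4
      omega
    rcases lt_or_gt_of_ne (h'.ne r u) with hlt | hgt
    · exact ih (2 * (n * u) + G - (2 * (n * r) + F)) (by omega) h' hrk hu (by omega) h3
    · exact ih (2 * (n * r) + F - (2 * (n * u) + G)) (by omega) h'.swap hu hrk (by omega) h3.symm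

theorem false_of_isPairing (h : CrossingCover n k f A B C D)
    (hf : IsPairing E 0 ((k + 1) * n) f) : False := by
  obtain ⟨t, ht, hr⟩ := h.coverAB 0 (Nat.zero_le k)
  rcases Nat.le_total (2 * (n * 0) + A) (2 * (n * t) + B) with hle | hle
  · exact not_sameRegion hf _ h (Nat.zero_le k) ht (Nat.add_sub_of_le hle) hr
  · exact not_sameRegion hf _ h.swap ht (Nat.zero_le k) (Nat.add_sub_of_le hle) hr.symm

end CrossingCover

/-- If `Red π = p` and `Red (Kr π)` is the partition `q`, then `q` refines the complement of `p`. -/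
theorem linked_kr_of_redBlocks {E : ℕ → ℕ → Prop} {n k : ℕ} {f : ℕ → ℕ} (hn : 0 < n)
    (hf : IsPairing E 0 ((k + 1) * n) f) {p : NCA n}
    {q : Finpartition (Finset.univ : Finset (Fin n))}
    (hp : redBlocks n k (pairingNC ((k + 1) * n) f).1 = p.1.parts)
    (hq : redBlocks n k (kr (pairingNC ((k + 1) * n) f)) = q.parts) {c d : Fin n}
    (hcd : Linked q c d) : Linked (kr p) c d := by
  rw [linked_kr]
  intro a b hab
  have hlift : ∀ (s : ℕ) (a : Fin n), s ≤ k → n * s + a < (k + 1) * n := by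
    intro s a hs
    have := Nat.mul_le_mul_left n hs
    have : (k + 1) * n = n * k + n := by ring
    omega
  have hred : ∀ (s : ℕ) (a : Fin n) (hs : s ≤ k), redPoint n k ⟨n * s + a, hlift s a hs⟩ = a := by
    intro s a hs
    apply Fin.ext
    rw [redPoint_val]
    simp only
    rw [Nat.mul_add_mod, Nat.mod_eq_of_lt a.2]
  have hdiv : ∀ j : Fin ((k + 1) * n), (j : ℕ) / n ≤ k ∧ n * (j / n) + redPoint n k j = j :=
    fun j => ⟨Nat.lt_succ_iff.1 ((Nat.div_lt_iff_lt_mul hn).2 j.2),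
      Nat.div_add_mod _ _⟩
  have hcover : ∀ a b, Linked p.1 a b → ∀ s ≤ k, ∃ t ≤ k,
      SameRegion f (2 * (n * s) + (2 * a + 1)) (2 * (n * t) + (2 * b + 1)) := by
    intro a b hab s hs
    obtain ⟨j, hj, rfl⟩ := (redBlocks_eq_parts_iff.1 hp).2 ⟨n * s + a, hlift s a hs⟩ b
      (by rwa [hred s _ hs])
    rw [linked_pairingNC] at hj
    obtain ⟨h1, h2⟩ := hdiv j
    refine ⟨j / n, h1, ?_⟩
    convert hj using 1
    · simp only
      ring
    · omega
  have hcover' : ∀ c d, Linked q c d → ∀ s ≤ k, ∃ t ≤ k,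
      SameRegion f (2 * (n * s) + (2 * c + 2)) (2 * (n * t) + (2 * d + 2)) := by
    intro c d hcd s hs
    obtain ⟨j, hj, rfl⟩ := (redBlocks_eq_parts_iff.1 hq).2 ⟨n * s + c, hlift s c hs⟩ d
      (by rwa [hred s _ hs])
    rw [linked_kr_pairingNC hf] at hj
    obtain ⟨h1, h2⟩ := hdiv j
    refine ⟨j / n, h1, ?_⟩
    convert hj using 1
    · simp only
      ring
    · omega
  by_contra hc
  refine CrossingCover.false_of_isPairing (A := 2 * a + 1) (B := 2 * b + 1) (C := 2 * c + 2)
    (D := 2 * d + 2) ⟨?_, ?_, ?_, ?_, ?_, ?_, ?_, ?_, ?_, ?_, ?_, ?_, hcover a b hab,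
      hcover b a (linked_symm hab), hcover' c d hcd, hcover' d c (linked_symm hcd)⟩ hf <;> omega

/-! ### Fibres of the reduction -/

/-- The fibre of `red` over the partition defined by `ρ` consists of the partitions defined by
the pairings that respect the colours of `ρ`. -/
noncomputable def fibreEquiv {D : ℕ → ℕ → Prop} {n : ℕ} (k : ℕ) {ρ : ℕ → ℕ} (hn : 0 < n)
    (hρ : IsPairing D 0 n ρ) :
    {f // IsPairing (Periodic n ρ) 0 ((k + 1) * n) f} ≃
      {π : NCK k n // red π = pairingNC n ρ} :=
  Equiv.ofBijective
    (fun f => ⟨⟨pairingNC ((k + 1) * n) f.1,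
      ⟨pairingNC n ρ, (hρ.redBlocks_pairingNC hn f.2).symm⟩,
      ⟨⟨kr (pairingNC n ρ), isNonCrossing_kr _⟩, (hρ.redBlocks_kr_pairingNC hn f.2).symm⟩⟩,
      Subtype.ext (Finpartition.ext (by
        rw [red_parts]
        exact hρ.redBlocks_pairingNC hn f.2))⟩) (by
    have hN : 0 < (k + 1) * n := by positivity
    constructor
    · rintro ⟨f, hf⟩ ⟨g, hg⟩ h
      exact Subtype.ext (pairingNC_injective hN hf hg
        (congrArg (fun π => π.1.1) h))
    · rintro ⟨⟨π, hπ⟩, hred⟩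
      obtain ⟨f, hf, rfl⟩ := exists_pairingNC_eq π
      have h1 := red_parts ⟨_, hπ⟩
      obtain ⟨q, hq⟩ := hπ.2
      rw [hred] at h1
      refine ⟨⟨f, hρ.periodic_of_le hn hf fun u v hu hv huv => ?_⟩, rfl⟩
      refine hf.sameRegion_imp (T := PeriodicRegion n ρ) (fun u v => PeriodicRegion.symm)
        (fun u v w => PeriodicRegion.trans) ?_ (fun i j hij => ?_) (fun i j hij => ?_) hu hv huv
      · apply PeriodicRegion.of_mod_eq
        rw [show 2 * ((k + 1) * n) = 2 * n * (k + 1) by ring]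
        simp
      · rw [hρ.periodicRegion_plain]
        exact (redBlocks_eq_parts_iff.1 h1.symm).1 i j hij
      · rw [hρ.periodicRegion_bar]
        -- It is enough that `q` refines the complement of the partition of `ρ`; equality is not
        -- needed to lift regions to regions.
        exact linked_kr_of_redBlocks hn hf h1.symm hq.symm
          ((redBlocks_eq_parts_iff.1 hq.symm).1 i j hij))

theorem card_fibre_red {n : ℕ} (k : ℕ) (hn : 0 < n) (p : NCA n) :
    Nat.card {π : NCK k n // red π = p} = raney (n + 1) (k + 1) 1 := by
  obtain ⟨ρ, hρ, rfl⟩ := exists_pairingNC_eq p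
  rw [← Nat.card_congr (fibreEquiv k hn hρ), card_periodic_pairing hn hρ, if_pos,
    Nat.mul_div_cancel _ hn, Nat.mul_mod_left]
  apply PeriodicRegion.of_mod_eq
  rw [show 0 + 2 * ((k + 1) * n) = 2 * n * (k + 1) by ring]
  simp

end NonCrossing

theorem mainTheorem1 (n k : ℕ) (hn : 0 < n) :
    Function.Surjective (NonCrossing.red : NonCrossing.NCK k n → NonCrossing.NCA n) ∧
    ∀ p : NonCrossing.NCA n,
      (Nat.card {π : NonCrossing.NCK k n // NonCrossing.red π = p} : ℚ) =
        1 / (((k : ℚ) + 1) * (n : ℚ) + 1) * (Nat.choose ((n + 1) * (k + 1)) (k + 1) : ℚ) := by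
  have hcard : ∀ p : NonCrossing.NCA n,
      (Nat.card {π : NonCrossing.NCK k n // NonCrossing.red π = p} : ℚ) =
        1 / (((k : ℚ) + 1) * (n : ℚ) + 1) * (Nat.choose ((n + 1) * (k + 1)) (k + 1) : ℚ) := by
    intro p
    rw [NonCrossing.card_fibre_red k hn p, NonCrossing.raney_one_eq]
    push_cast
    rfl
  refine ⟨fun p => ?_, hcard⟩
  have hpos : 0 < Nat.choose ((n + 1) * (k + 1)) (k + 1) :=
    Nat.choose_pos (Nat.le_mul_of_pos_left _ n.succ_pos)
  have hne : Nat.card {π : NonCrossing.NCK k n // NonCrossing.red π = p} ≠ 0 := by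
    have h : (0 : ℚ) < 1 / (((k : ℚ) + 1) * (n : ℚ) + 1) *
        (Nat.choose ((n + 1) * (k + 1)) (k + 1) : ℚ) := by positivity
    rw [← hcard p] at h
    exact_mod_cast h.ne'
  obtain ⟨⟨π, hπ⟩⟩ := (Nat.card_ne_zero.1 hne).1
  exact ⟨π, hπ⟩
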